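/- Let $G$ be a simple complex algebraic group (for instance simply connected), with maximal torus $T$, Borel subgroup $B\supset T$, and $N$ the unipotent radical of $B$. Let $\mathfrak g,\mathfrak t,\mathfrak n$ be the Lie algebras of $G,T,N$, let $\{\alpha_i\}_{i\in I}$ be the simple roots, and let $Q_+$ be the $\mathbb Z_{\ge 0}$-span of the positive roots. Realize $G$ as a closed subgroup of some $GL_m(\mathbb C)$, so that $\mathfrak g\subset\mathfrak{gl}_m(\mathbb C)$, $\mathrm{Ad}$ is conjugation, $N$ is the group generated by $\exp(\mathfrak n)$, and $\mathbb C[N]$ is the algebra of polynomial functions in the matrix entries. The algebra $U(\mathfrak n)$ acts on $\mathbb C[N]$ by $(a\cdot f)(g)=\frac{d}{dt}\big|_{t=0}f(g\exp(ta))$ for $a\in\mathfrak n$; put $\langle a,f\rangle:=(a\cdot f)(1_N)$ for $a\in U(\mathfrak n)$, $f\in\mathbb C[N]$. For each $i\in I$ fix a nonzero root vector $\dot e_i\in\mathfrak n$ of weight $\alpha_i$, and let $\dot e=\sum_{i\in I}\dot e_i$. Let $\mathfrak t^{\mathrm{reg}}$ be the set of $x\in\mathfrak t$ with $\langle\alpha,x\rangle\ne0$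 for all roots $\alpha$, and let $\mathbb C[\mathfrak t^{\mathrm{reg}}]$ be its algebra of regular functions, generated by the linear forms and the inverses of the roots. For a finite sequence $\mathbf i=(i_1,\dots,i_p)$ of elements of $I$ ($p\ge0$), let $\dot e_{\mathbf i}=\dot e_{i_1}\cdots\dot e_{i_p}\in U(\mathfrak n)$, let $\beta_k=\alpha_{i_1}+\dots+\alpha_{i_k}$ for $0\le k\le p$, and let $\overline D_{\mathbf i}=\prod_{k=0}^{p-1}\frac{1}{\beta_k-\beta_p}$. Then for each $x\in\mathfrak t^{\mathrm{reg}}$ there is a unique $n_x\in N$ with $\mathrm{Ad}_{n_x}(x)=x+\dot e$, and there is an algebra morphism $\overline D:\mathbb C[N]\to\mathbb C[\mathfrak t^{\mathrm{reg}}]$ with $\overline D(f)(x)=f(n_x)$ for all $f\in\mathbb C[N]$ and $x\in\mathfrak t^{\mathrm{reg}}$ (so $x\mapsto n_x$ is a regular map, and $\overline D$ is the algebra map dual to it). Moreover, for each $f\in\mathbb C[N]$ one has $\langle\dot e_{\mathbf i},f\rangle\neq0$ for only finitely many sequences $\mathbf i$, and for every $x\in\mathfrak t^{\mathrm{reg}}$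 such that $\langle\beta,x\rangle\ne0$ for all $\beta\in Q_+\setminus\{0\}$, $$\overline D(f)(x)=f(n_x)=\sum_{\mathbf i}\langle\dot e_{\mathbf i},f\rangle\,\overline D_{\mathbf i}(x),$$ the sum being over all finite sequences $\mathbf i$ of elements of $I$. -/

import Mathlib

open LieAlgebra LieAlgebra.IsKilling Module

attribute [local instance 100] LieRing.ofAssociativeRing

noncomputable section

section LieTheory

variable {𝔤 : Type*} [LieRing 𝔤] [LieAlgebra ℂ 𝔤] [FiniteDimensional ℂ 𝔤] [LieAlgebra.IsSimple ℂ 𝔤]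
  {𝔱 : LieSubalgebra ℂ 𝔤} [𝔱.IsCartanSubalgebra]

/-- The bracket of two positive root spaces lies in the sum of the positive root spaces. -/
theorem lie_mem_iSup_posRootSpace (b : (rootSystem 𝔱).Base) {α β : 𝔱.root}
    (hα : b.IsPos α) (hβ : b.IsPos β) {x y : 𝔤}
    (hx : x ∈ rootSpace 𝔱 (α : LieModule.Weight ℂ 𝔱 𝔤))
    (hy : y ∈ rootSpace 𝔱 (β : LieModule.Weight ℂ 𝔱 𝔤)) :
    ⁅x, y⁆ ∈ ⨆ γ : {γ : 𝔱.root // b.IsPos γ},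
      (rootSpace 𝔱 (γ.1 : LieModule.Weight ℂ 𝔱 𝔤)).toSubmodule := by
  have h : ⁅x, y⁆ ∈
      rootSpace 𝔱 (⇑(α : LieModule.Weight ℂ 𝔱 𝔤) + ⇑(β : LieModule.Weight ℂ 𝔱 𝔤)) :=
    LieAlgebra.lie_mem_genWeightSpace_of_mem_genWeightSpace hx hy
  by_cases hbot : rootSpace 𝔱 (⇑(α : LieModule.Weight ℂ 𝔱 𝔤) + ⇑(β : LieModule.Weight ℂ 𝔱 𝔤)) = ⊥
  · rw [hbot] at h
    rw [(LieSubmodule.mem_bot _).1 h]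
    exact zero_mem _
  · let w : LieModule.Weight ℂ 𝔱 𝔤 := ⟨_, hbot⟩
    have hw0 : w.IsNonZero := by
      intro h0
      have hz : (⇑(α : LieModule.Weight ℂ 𝔱 𝔤) + ⇑(β : LieModule.Weight ℂ 𝔱 𝔤)) = 0 := h0
      have hneg : (rootSystem 𝔱).root β = -(rootSystem 𝔱).root α := by
        ext t
        have := congrFun hz t
        simp only [Pi.add_apply, Pi.zero_apply] at this
        simp only [rootSystem_root_apply, LieModule.Weight.toLinear_apply, LinearMap.neg_apply]
        linear_combination this
      let := (rootSystem 𝔱).indexNeg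
      have hβ' : β = -α := (rootSystem 𝔱).root.injective
        (hneg.trans (by
          rw [RootPairing.indexNeg_neg, RootPairing.root_reflectionPerm,
            RootPairing.reflection_apply_self]))
      exact ((RootPairing.Base.IsPos.neg_iff_not b α).1 (hβ' ▸ hβ)) hα
    let γ : 𝔱.root := ⟨w, by simpa using hw0⟩
    have hγ : b.IsPos γ := hα.add hβ (by ext t; simp [γ, w])
    exact Submodule.mem_iSup_of_mem (⟨γ, hγ⟩ : {γ : 𝔱.root // b.IsPos γ}) h

/-- The nilpotent Lie algebra `𝔫 = ⨁_{α > 0} 𝔤_α` attached to a base of the root system. -/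
def nilpotentPart (b : (rootSystem 𝔱).Base) : LieSubalgebra ℂ 𝔤 where
  toSubmodule := ⨆ γ : {γ : 𝔱.root // b.IsPos γ},
    (rootSpace 𝔱 (γ.1 : LieModule.Weight ℂ 𝔱 𝔤)).toSubmodule
  lie_mem' := by
    intro x y hx hy
    change x ∈ ⨆ γ : {γ : 𝔱.root // b.IsPos γ},
      (rootSpace 𝔱 (γ.1 : LieModule.Weight ℂ 𝔱 𝔤)).toSubmodule at hx
    change y ∈ ⨆ γ : {γ : 𝔱.root // b.IsPos γ},
      (rootSpace 𝔱 (γ.1 : LieModule.Weight ℂ 𝔱 𝔤)).toSubmodule at hy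
    change ⁅x, y⁆ ∈ ⨆ γ : {γ : 𝔱.root // b.IsPos γ},
      (rootSpace 𝔱 (γ.1 : LieModule.Weight ℂ 𝔱 𝔤)).toSubmodule
    induction hx using Submodule.iSup_induction' with
    | zero => rw [zero_lie]; exact Submodule.zero_mem _
    | add x x' _ _ h h' => rw [add_lie]; exact Submodule.add_mem _ h h'
    | mem α x hx =>
      induction hy using Submodule.iSup_induction' with
      | zero => rw [lie_zero]; exact Submodule.zero_mem _
      | add y y' _ _ h h' => rw [lie_add]; exact Submodule.add_mem _ h h'
      | mem β y hy => exact lie_mem_iSup_posRootSpace b α.2 β.2 hx hy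

/-- The monoid `Q₊`, spanned over `ℤ_{≥ 0}` by the positive roots. -/
def rootCone (b : (rootSystem 𝔱).Base) : AddSubmonoid (Dual ℂ 𝔱) :=
  AddSubmonoid.closure {β | ∃ α : 𝔱.root, b.IsPos α ∧ β = (rootSystem 𝔱).root α}

variable (𝔱) in
/-- The set `𝔱^reg` of regular elements of the Cartan subalgebra `𝔱`. -/
def RegularElement : Type _ := {x : 𝔱 // ∀ α : 𝔱.root, (rootSystem 𝔱).root α x ≠ 0}

variable (𝔱) in
/-- The algebra `ℂ[𝔱^reg]` of regular functions on `𝔱^reg`, which is the principal open subset of the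
affine space `𝔱` where the product of the roots does not vanish: it is generated by the linear forms
and by the inverses of the roots. -/
def regularFunctions : Subalgebra ℂ (RegularElement 𝔱 → ℂ) :=
  Algebra.adjoin ℂ
    ({f | ∃ l : Dual ℂ 𝔱, f = fun x => l x.1} ∪
      {f | ∃ α : 𝔱.root, f = fun x => ((rootSystem 𝔱).root α x.1)⁻¹})

/-- The weight `β_k = α_{i₁} + ⋯ + α_{i_k}` of a sequence `(i₁, …, i_p)` of elements of the set `I`
indexing the simple roots. -/
def partialWeight (b : (rootSystem 𝔱).Base) (i : List b.support) (k : ℕ) : Dual ℂ 𝔱 :=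
  ((i.take k).map fun j => (rootSystem 𝔱).root j).sum

/-- The value at `x` of the rational function `∏_{k = 0}^{p - 1} 1 / (β_k - β_p)`. -/
def seqCoeff (b : (rootSystem 𝔱).Base) (i : List b.support) (x : 𝔱) : ℂ :=
  ∏ k ∈ Finset.range i.length,
    1 / (partialWeight b i k x - partialWeight b i i.length x)

/-- The monomial `ė_{i₁} ⋯ ė_{i_p}` in the enveloping algebra `U(𝔫)`. -/
def seqMonomial (b : (rootSystem 𝔱).Base) (e : b.support → nilpotentPart b) (i : List b.support) :
    UniversalEnvelopingAlgebra ℂ (nilpotentPart b) :=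
  (i.map fun j => UniversalEnvelopingAlgebra.ι ℂ (e j)).prod

end LieTheory

section MatrixGroups

variable {m : ℕ}

/-- The exponential of a complex matrix, as an invertible matrix. -/
def expGL (A : Matrix (Fin m) (Fin m) ℂ) : GL (Fin m) ℂ := (Matrix.isUnit_exp A).unit

/-- The algebra of polynomial functions in the matrix entries on a group of matrices. For a Zariski
closed group of matrices of determinant one, this is its algebra of regular functions. -/
def coordRing (N : Subgroup (GL (Fin m) ℂ)) : Subalgebra ℂ (N → ℂ) :=
  Algebra.adjoin ℂ (Set.range fun (p : Fin m × Fin m) (g : N) => (g : GL (Fin m) ℂ) p.1 p.2)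

variable {L : Type*} [LieRing L] [LieAlgebra ℂ L]

/-- The group of matrices generated by the exponentials of a Lie algebra of matrices. -/
def expGroup (ρ : L →ₗ⁅ℂ⁆ Matrix (Fin m) (Fin m) ℂ) : Subgroup (GL (Fin m) ℂ) :=
  Subgroup.closure (Set.range fun a : L => expGL (ρ a))

/-- The element `exp a` of the group, for `a` in the Lie algebra. -/
def groupExp (ρ : L →ₗ⁅ℂ⁆ Matrix (Fin m) (Fin m) ℂ) (a : L) : expGroup ρ :=
  ⟨expGL (ρ a), Subgroup.subset_closure ⟨a, rfl⟩⟩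

/-- The infinitesimal left action `(a · f)(g) = d/dt|_{t = 0} f (g exp (t a))` on functions, derived
from the action `n · f = f(? n)` of the group. -/
def infAct (ρ : L →ₗ⁅ℂ⁆ Matrix (Fin m) (Fin m) ℂ) (a : L) (f : expGroup ρ → ℂ) :
    expGroup ρ → ℂ :=
  fun g => deriv (fun t : ℂ => f (g * groupExp ρ (t • a))) 0

variable (ρ : L →ₗ⁅ℂ⁆ Matrix (Fin m) (Fin m) ℂ)

open scoped Matrix.Norms.Operator in
theorem hasDerivAt_entry (a : L) (g : expGroup ρ) (i j : Fin m) :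
    HasDerivAt (fun t : ℂ => ((g * groupExp ρ (t • a) : expGroup ρ) : GL (Fin m) ℂ) i j)
      (∑ k, (g : GL (Fin m) ℂ) i k * ρ a k j) 0 := by
  have h := hasDerivAt_exp_smul_const (𝕂 := ℂ) (ρ a) (0 : ℂ)
  have h2 := (hasDerivAt_const (0 : ℂ) ((g : GL (Fin m) ℂ) : Matrix (Fin m) (Fin m) ℂ)).mul h
  have h3 := hasDerivAt_pi.1 (hasDerivAt_pi.1 h2 i) j
  simp only [zero_smul, NormedSpace.exp_zero, one_mul, zero_mul, zero_add, Pi.mul_apply,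
    Matrix.mul_apply] at h3
  simp only [groupExp, expGL, map_smul, Subgroup.coe_mul, Units.val_mul, Matrix.mul_apply,
    IsUnit.unit_spec]
  exact h3

theorem differentiableAt_of_mem (a : L) {f : expGroup ρ → ℂ} (hf : f ∈ coordRing (expGroup ρ))
    (g : expGroup ρ) :
    DifferentiableAt ℂ (fun t : ℂ => f (g * groupExp ρ (t • a))) 0 := by
  induction hf using Algebra.adjoin_induction with
  | mem f h =>
    obtain ⟨p, rfl⟩ := h
    exact (hasDerivAt_entry ρ a g p.1 p.2).differentiableAt
  | algebraMap r => exact differentiableAt_const r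
  | add f f' _ _ h h' => exact h.add h'
  | mul f f' _ _ h h' => exact h.mul h'

theorem infAct_entry (a : L) (i j : Fin m) :
    infAct ρ a (fun g => (g : GL (Fin m) ℂ) i j) =
      ∑ k, ρ a k j • fun g : expGroup ρ => (g : GL (Fin m) ℂ) i k := by
  funext g
  rw [infAct, (hasDerivAt_entry ρ a g i j).deriv]
  simp [mul_comm]

theorem groupExp_zero_smul (a : L) : groupExp ρ ((0 : ℂ) • a) = 1 := by
  ext
  simp [groupExp, expGL]

theorem infAct_add (a : L) {f f' : expGroup ρ → ℂ} (hf : f ∈ coordRing (expGroup ρ))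
    (hf' : f' ∈ coordRing (expGroup ρ)) :
    infAct ρ a (f + f') = infAct ρ a f + infAct ρ a f' := by
  funext g
  exact deriv_add (differentiableAt_of_mem ρ a hf g) (differentiableAt_of_mem ρ a hf' g)

theorem infAct_mul (a : L) {f f' : expGroup ρ → ℂ} (hf : f ∈ coordRing (expGroup ρ))
    (hf' : f' ∈ coordRing (expGroup ρ)) :
    infAct ρ a (f * f') = f * infAct ρ a f' + f' * infAct ρ a f := by
  funext g
  have h := deriv_mul (differentiableAt_of_mem ρ a hf g) (differentiableAt_of_mem ρ a hf' g)
  simp only [groupExp_zero_smul, mul_one] at h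
  refine h.trans ?_
  simp only [infAct, Pi.add_apply, Pi.mul_apply]
  ring

theorem infAct_const (a : L) (r : ℂ) :
    infAct ρ a (algebraMap ℂ (expGroup ρ → ℂ) r) = 0 := by
  funext g
  exact deriv_const _ r

theorem infAct_mem (a : L) {f : expGroup ρ → ℂ} (hf : f ∈ coordRing (expGroup ρ)) :
    infAct ρ a f ∈ coordRing (expGroup ρ) := by
  induction hf using Algebra.adjoin_induction with
  | mem f h =>
    obtain ⟨p, rfl⟩ := h
    rw [infAct_entry]
    exact Subalgebra.sum_mem _ fun k _ =>
      Subalgebra.smul_mem _ (Algebra.subset_adjoin (Set.mem_range_self (p.1, k))) _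
  | algebraMap r => rw [infAct_const]; exact zero_mem _
  | add f f' hf hf' h h' => rw [infAct_add ρ a hf hf']; exact add_mem h h'
  | mul f f' hf hf' h h' =>
    rw [infAct_mul ρ a hf hf']
    exact add_mem (mul_mem hf h') (mul_mem hf' h)

/-- The action of an element of the Lie algebra on the regular functions. -/
def infActEnd (a : L) : Derivation ℂ (coordRing (expGroup ρ)) (coordRing (expGroup ρ)) :=
  Derivation.mk'
    { toFun := fun f => ⟨infAct ρ a f, infAct_mem ρ a f.2⟩
      map_add' := fun f f' => Subtype.ext (infAct_add ρ a f.2 f'.2)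
      map_smul' := fun r f => Subtype.ext (by
        have h := infAct_mul ρ a (Subalgebra.algebraMap_mem (coordRing (expGroup ρ)) r) f.2
        rw [infAct_const, mul_zero, add_zero, ← Algebra.smul_def, ← Algebra.smul_def] at h
        exact h) }
    (fun f f' => Subtype.ext (infAct_mul ρ a f.2 f'.2))

/-- The matrix entries as elements of the algebra of regular functions. -/
def entry (i j : Fin m) : coordRing (expGroup ρ) :=
  ⟨fun g => (g : GL (Fin m) ℂ) i j, Algebra.subset_adjoin ⟨(i, j), rfl⟩⟩

theorem adjoin_entry :
    Algebra.adjoin ℂ (Set.range fun p : Fin m × Fin m => entry ρ p.1 p.2) = ⊤ := by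
  have h := Algebra.adjoin_adjoin_coe_preimage (R := ℂ) (s := Set.range
    fun (p : Fin m × Fin m) (g : expGroup ρ) => (g : GL (Fin m) ℂ) p.1 p.2)
  refine top_le_iff.1 ((show ⊤ ≤ _ from h.ge).trans (Algebra.adjoin_mono ?_))
  rintro f ⟨p, hp⟩
  exact ⟨p, Subtype.ext hp⟩

theorem infActEnd_entry (a : L) (i j : Fin m) :
    infActEnd ρ a (entry ρ i j) = ∑ k, ρ a k j • entry ρ i k := by
  apply Subtype.ext
  refine (infAct_entry ρ a i j).trans ?_
  simp [entry]

/-- The left action of the Lie algebra on the algebra of regular functions. -/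
def lieAction : L →ₗ⁅ℂ⁆ Module.End ℂ (coordRing (expGroup ρ)) where
  toFun a := (infActEnd ρ a).toLinearMap
  map_add' a a' := by
    have h : infActEnd ρ (a + a') = infActEnd ρ a + infActEnd ρ a' :=
      Derivation.ext_of_adjoin_eq_top _ (adjoin_entry ρ) (by
        rintro _ ⟨p, rfl⟩
        simp [infActEnd_entry, add_smul, Finset.sum_add_distrib])
    rw [h]; rfl
  map_smul' r a := by
    have h : infActEnd ρ (r • a) = r • infActEnd ρ a :=
      Derivation.ext_of_adjoin_eq_top _ (adjoin_entry ρ) (by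
        rintro _ ⟨p, rfl⟩
        simp [infActEnd_entry, mul_smul, Finset.smul_sum])
    rw [h]; rfl
  map_lie' {a a'} := by
    have h : infActEnd ρ ⁅a, a'⁆ = ⁅infActEnd ρ a, infActEnd ρ a'⁆ :=
      Derivation.ext_of_adjoin_eq_top _ (adjoin_entry ρ) (by
        rintro _ ⟨p, rfl⟩
        have key : ∀ c c' : L, infActEnd ρ c (infActEnd ρ c' (entry ρ p.1 p.2)) =
            ∑ l, (ρ c * ρ c') l p.2 • entry ρ p.1 l := by
          intro c c'
          simp only [infActEnd_entry, map_sum, Derivation.map_smul, Finset.smul_sum, smul_smul,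
            Matrix.mul_apply, Finset.sum_smul]
          rw [Finset.sum_comm]
          simp only [mul_comm]
        rw [Derivation.commutator_apply, key, key, infActEnd_entry, LieHom.map_lie]
        simp [Ring.lie_def, sub_smul, Finset.sum_sub_distrib])
    rw [h]; rfl

/-- The pairing `⟨a, f⟩ = (a · f)(1)` between the enveloping algebra of the Lie algebra and the
algebra of regular functions on the group. -/
def envPairing (a : UniversalEnvelopingAlgebra ℂ L) (f : coordRing (expGroup ρ)) : ℂ :=
  (UniversalEnvelopingAlgebra.lift ℂ (lieAction ρ) a f : expGroup ρ → ℂ) 1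

end MatrixGroups

section Unipotent

variable {𝔤 : Type*} [LieRing 𝔤] [LieAlgebra ℂ 𝔤] [FiniteDimensional ℂ 𝔤] [LieAlgebra.IsSimple ℂ 𝔤]
  {𝔱 : LieSubalgebra ℂ 𝔤} [𝔱.IsCartanSubalgebra] {m : ℕ}

/-- The restriction to `𝔫` of a matrix representation of `𝔤`. -/
def nilpotentRep (b : (rootSystem 𝔱).Base) (ρ : 𝔤 →ₗ⁅ℂ⁆ Matrix (Fin m) (Fin m) ℂ) :
    nilpotentPart b →ₗ⁅ℂ⁆ Matrix (Fin m) (Fin m) ℂ :=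
  ρ.comp (nilpotentPart b).incl

/-- The maximal unipotent group `N`, with Lie algebra `𝔫`, in the matrix group `G` with Lie algebra
`ρ(𝔤)`: the group generated by the exponentials of the elements of `ρ(𝔫)`. It is the unipotent radical
of the Borel subgroup of `G` with Lie algebra `ρ(𝔱 ⊕ 𝔫)`. -/
abbrev unipotentGroup (b : (rootSystem 𝔱).Base) (ρ : 𝔤 →ₗ⁅ℂ⁆ Matrix (Fin m) (Fin m) ℂ) :
    Subgroup (GL (Fin m) ℂ) :=
  expGroup (nilpotentRep b ρ)

/-- The relation `Ad_g y = z`, where `g` is an invertible matrix acting by conjugation on matrices, and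
the Lie algebra `𝔤` is embedded into matrices by the representation `ρ`. -/
def AdEq (ρ : 𝔤 →ₗ⁅ℂ⁆ Matrix (Fin m) (Fin m) ℂ) (g : GL (Fin m) ℂ) (y z : 𝔤) : Prop :=
  (g : Matrix (Fin m) (Fin m) ℂ) * ρ y * ((g⁻¹ : GL (Fin m) ℂ) : Matrix (Fin m) (Fin m) ℂ) = ρ z

end Unipotent

end

/-! The adjoint action of `ρ(𝔱)` defines weight spaces in the matrix algebra. Evaluating weights at
the element of `𝔱` where every simple root equals `1` gives a filtration by integral degree: degrees
add under products, `ρ(𝔫)` has degree at least `1`, and by finite dimension large degrees vanish.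
Hence `N` lies in `1 + (positive degree)`, and equations in `N` can be solved degree by degree in
finitely many steps.

Existence and regularity of `n_x`. Suppose `n x n⁻¹ = x + e + r` with `r` of degree at least `k`,
and let `r_k` be its degree `k` part. Multiplying `n` on the left by `exp y`, where `[y, x] = -r_k`,
moves the error to degree `k + 1`. Solving for `y` divides each root component of `r_k` by the value
of that root at `x`, so only inverses of roots enter (`exists_regular_conj_step`).

Uniqueness. It suffices that an element `g` of `N` commuting with a regular `x` is `1`. The leading
term `X` of `g - 1` commutes with `x`, but weights of the matrix algebra need not be roots and may
vanish at `x`. However `N` normalizes `ρ(𝔤)`, so `[X, ·]` induces a derivation of `𝔤`. Derivations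
of `𝔤` are inner, which puts `X` in `ρ(𝔫)`, where regularity of `x` gives `X = 0`
(`eq_one_of_commute`).

The formula. The condition on `n_x` reads `[x, n_x] = -e n_x`. The sum of the matrices of the words,
weighted by `seqCoeff`, solves the same equation by the recursion `seqCoeff_cons`, and for generic
`x` the solution in `1 + (positive degree)` is unique (`coe_eq_finsum_wordMatrix`). This is the
formula for matrix entries. Both sides are multiplicative in `f`: elements of `𝔫` act as
derivations, so pairing with words turns products of functions into shuffle products, and the same
recursion makes `seqCoeff` a character of the shuffle algebra (`sum_map_shuffles`). Since the
entries generate `ℂ[N]`, the formula holds for all `f`. -/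

noncomputable section

/-! ### Shuffles of words and characters of the shuffle product -/

section Shuffle

variable {α : Type*}

/-- The list of shuffles of two words. -/
def shuffles : List α → List α → List (List α)
  | [], v => [v]
  | a :: u, [] => [a :: u]
  | a :: u, b :: v => (shuffles u (b :: v)).map (a :: ·) ++ (shuffles (a :: u) v).map (b :: ·)
termination_by u v => u.length + v.length

/-- The list of ways to split a word into two complementary subwords. -/
def unshuffles : List α → List (List α × List α)
  | [] => [([], [])]
  | a :: w => (unshuffles w).map (fun p => (a :: p.1, p.2)) ++
      (unshuffles w).map (fun p => (p.1, a :: p.2))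

theorem shuffles_nil_left (v : List α) : shuffles [] v = [v] := by rw [shuffles]

theorem shuffles_nil_right (u : List α) : shuffles u [] = [u] := by
  cases u <;> rw [shuffles]

theorem shuffles_cons_cons (a b : α) (u v : List α) :
    shuffles (a :: u) (b :: v) =
      (shuffles u (b :: v)).map (a :: ·) ++ (shuffles (a :: u) v).map (b :: ·) := by
  rw [shuffles]

theorem count_map_cons [DecidableEq α] (a b : α) (w : List α) (L : List (List α)) :
    (L.map (a :: ·)).count (b :: w) = if a = b then L.count w else 0 := by
  split_ifs with h
  · subst h
    exact List.count_map_of_injective L _ (List.cons_injective) w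
  · exact List.count_eq_zero_of_not_mem (by simp [h])

/-- Sending the first letter of `w` to `u` or to `v` mirrors the choice of the first letter of a
shuffle. This adjunction, with multiplicities, converts sums over splittings of words into sums over
pairs of words. -/
theorem count_unshuffles [DecidableEq α] (w u v : List α) :
    (unshuffles w).count (u, v) = (shuffles u v).count w := by
  have h1 : ∀ (L : List (List α × List α)) (c a : α) (u v : List α),
      (L.map (fun p => (c :: p.1, p.2))).count (a :: u, v) = if c = a then L.count (u, v) else 0 := by
    intro L c a u v
    split_ifs with h
    · subst h
      exact List.count_map_of_injective L (fun p => (c :: p.1, p.2))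
        (by rintro ⟨_, _⟩ ⟨_, _⟩ h; simpa using h) (u, v)
    · exact List.count_eq_zero_of_not_mem (by simp [h])
  have h2 : ∀ (L : List (List α × List α)) (c a : α) (u v : List α),
      (L.map (fun p => (p.1, c :: p.2))).count (u, a :: v) = if c = a then L.count (u, v) else 0 := by
    intro L c a u v
    split_ifs with h
    · subst h
      exact List.count_map_of_injective L (fun p => (p.1, c :: p.2))
        (by rintro ⟨_, _⟩ ⟨_, _⟩ h; simpa using h) (u, v)
    · exact List.count_eq_zero_of_not_mem (by simp [h])
  have h3 : ∀ (L : List (List α × List α)) (c : α) (v : List α),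
      (L.map (fun p => (c :: p.1, p.2))).count ([], v) = 0 := fun L c v =>
    List.count_eq_zero_of_not_mem (by simp)
  have h4 : ∀ (L : List (List α × List α)) (c : α) (u : List α),
      (L.map (fun p => (p.1, c :: p.2))).count (u, []) = 0 := fun L c v =>
    List.count_eq_zero_of_not_mem (by simp)
  induction w generalizing u v with
  | nil =>
    rcases u with _ | ⟨a, u⟩ <;> rcases v with _ | ⟨b, v⟩ <;>
      simp [unshuffles, shuffles_nil_left, shuffles_nil_right, shuffles_cons_cons]
    rw [List.count_eq_zero_of_not_mem, List.count_eq_zero_of_not_mem] <;> simp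
  | cons c w ih =>
    rcases u with _ | ⟨a, u⟩ <;> rcases v with _ | ⟨b, v⟩
    · simp [unshuffles, shuffles_nil_left, h3, h4]
    · simp [unshuffles, shuffles_nil_left, h2, h3, ih, List.count_cons]
      grind
    · simp [unshuffles, shuffles_nil_right, h1, h4, ih, List.count_cons]
      grind
    · rw [unshuffles, shuffles_cons_cons, List.count_append, List.count_append, h1, h2, ih, ih,
        count_map_cons, count_map_cons]
      grind

variable (β : α → ℂ)

theorem sum_of_mem_shuffles (u v : List α) :
    ∀ w ∈ shuffles u v, (w.map β).sum = (u.map β).sum + (v.map β).sum := by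
  fun_induction shuffles u v with
  | case1 v => simp
  | case2 a u => simp
  | case3 a u b v ih1 ih2 =>
    intro w hw
    simp only [List.mem_append, List.mem_map] at hw
    rcases hw with ⟨w, hw, rfl⟩ | ⟨w, hw, rfl⟩
    · simp only [List.map_cons, List.sum_cons, ih1 w hw]; ring
    · simp only [List.map_cons, List.sum_cons, ih2 w hw]; ring

/-- If `c` satisfies `(β_{i₁} + ⋯ + β_{i_p}) c(i₁, …, i_p) = - c(i₂, …, i_p)`, then it is
multiplicative for the shuffle product. -/
theorem sum_map_shuffles {c : List α → ℂ} (hβ : ∀ l ≠ [], (l.map β).sum ≠ 0) (c_nil : c [] = 1)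
    (c_cons : ∀ a l, ((a :: l).map β).sum * c (a :: l) = - c l) (u v : List α) :
    ((shuffles u v).map c).sum = c u * c v := by
  fun_induction shuffles u v with
  | case1 v => simp [c_nil]
  | case2 a u => simp [c_nil]
  | case3 a u b v ih1 ih2 =>
    have key : ∀ (d : α) (L : List (List α)) (s : ℂ), (∀ w ∈ L, β d + (w.map β).sum = s) →
        s * ((L.map (d :: ·)).map c).sum = -(L.map c).sum := by
      intro d L s h
      induction L with
      | nil => simp
      | cons w L ih =>
        have h0 := c_cons d w
        rw [List.map_cons, List.sum_cons, h w (by simp)] at h0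
        have := ih fun w' hw' => h w' (by simp [hw'])
        simp only [List.map_cons, List.sum_cons] at this ⊢
        linear_combination h0 + this
    set s := ((a :: u).map β).sum + ((b :: v).map β).sum with hs
    have hs0 : s ≠ 0 := by
      have := hβ ((a :: u) ++ (b :: v)) (by simp)
      rwa [List.map_append, List.sum_append] at this
    have k1 := key a (shuffles u (b :: v)) s fun w hw => by
      rw [sum_of_mem_shuffles β _ _ w hw, hs]; simp only [List.map_cons, List.sum_cons]; ring
    have k2 := key b (shuffles (a :: u) v) s fun w hw => by
      rw [sum_of_mem_shuffles β _ _ w hw, hs]; simp only [List.map_cons, List.sum_cons]; ring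
    rw [ih1] at k1
    rw [ih2] at k2
    rw [List.map_append, List.sum_append]
    -- After multiplication by `s`, the shuffles starting with `a` contribute `-c u * c (b :: v)`
    -- and those starting with `b` contribute `-c (a :: u) * c v`. Splitting `s` into the weights of
    -- the two words gives the same for `s * (c (a :: u) * c (b :: v))`.
    apply mul_left_cancel₀ hs0
    have e1 := c_cons a u
    have e2 := c_cons b v
    rw [hs] at k1 k2 ⊢
    linear_combination k1 + k2 - c (b :: v) * e1 - c (a :: u) * e2

variable {R : Type*} [CommRing R] [Algebra ℂ R] (δ : α → Module.End ℂ R)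

theorem prod_map_mul_eq_sum_unshuffles
    (hδ : ∀ i f g, δ i (f * g) = f * δ i g + g * δ i f) (w : List α) (f g : R) :
    (w.map δ).prod (f * g) =
      ((unshuffles w).map fun p => (p.1.map δ).prod f * (p.2.map δ).prod g).sum := by
  induction w with
  | nil => simp [unshuffles]
  | cons a w ih =>
    rw [List.map_cons, List.prod_cons, Module.End.mul_apply, ih, unshuffles, List.map_append,
      List.sum_append, map_list_sum, List.map_map, List.map_map, List.map_map, ← List.sum_map_add]
    congr 1
    refine List.map_congr_left fun p _ => ?_
    simp only [Function.comp_apply, hδ, List.map_cons, List.prod_cons, Module.End.mul_apply]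
    ring

/-- The sum of a function over the splittings of a word, when the function is supported in a finite
set. -/
theorem sum_map_unshuffles_eq [DecidableEq α] {A : List α × List α → ℂ}
    {S : Finset (List α × List α)}
    (hS : ∀ p, A p ≠ 0 → p ∈ S) (w : List α) :
    ((unshuffles w).map A).sum = ∑ p ∈ S, A p * ((shuffles p.1 p.2).count w : ℂ) := by
  have h : ∀ L : List (List α × List α), (L.map A).sum = ∑ p ∈ S, A p * (L.count p : ℂ) := by
    intro L
    induction L with
    | nil => simp
    | cons q L ih =>
      simp only [List.map_cons, List.sum_cons, ih, List.count_cons, Nat.cast_add, mul_add,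
        Finset.sum_add_distrib]
      rw [add_comm]
      congr 1
      by_cases hq : A q = 0
      · rw [hq, Finset.sum_eq_zero]
        intro p _
        by_cases hp : q = p
        · simp [← hp, hq]
        · simp [hp]
      · rw [Finset.sum_eq_single_of_mem q (hS q hq)]
        · simp
        · intro p _ hp
          simp [hp.symm]
  rw [h]
  exact Finset.sum_congr rfl fun p _ => by rw [← count_unshuffles]

theorem finite_support_unshuffles {A : List α × List α → ℂ} (hA : A.support.Finite) :
    (Function.support fun w => ((unshuffles w).map A).sum).Finite := by
  classical
  refine Set.Finite.subset (hA.toFinset.biUnion fun p => (shuffles p.1 p.2).toFinset).finite_toSet ?_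
  intro w hw
  rw [Function.mem_support, sum_map_unshuffles_eq (S := hA.toFinset) (by simp)] at hw
  obtain ⟨p, hp, hp'⟩ := Finset.exists_ne_zero_of_sum_ne_zero hw
  simp only [Finset.coe_biUnion, Set.mem_iUnion, Finset.mem_coe]
  refine ⟨p, hp, ?_⟩
  rw [List.mem_toFinset, ← List.count_pos_iff, Nat.pos_iff_ne_zero]
  intro h
  simp [h] at hp'

/-- By `count_unshuffles` the sum over `w` becomes a sum over pairs `(u, v)` of `F u * G v` times
the sum of `c` over the shuffles of `u` and `v`, which is `c u * c v`. With `F`, `G` the pairings of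
two functions with words, this is multiplicativity of the expansion. -/
theorem finsum_unshuffles {c : List α → ℂ} (hβ : ∀ l ≠ [], (l.map β).sum ≠ 0) (c_nil : c [] = 1)
    (c_cons : ∀ a l, ((a :: l).map β).sum * c (a :: l) = - c l) {F G : List α → ℂ}
    (hF : F.support.Finite) (hG : G.support.Finite) :
    ∑ᶠ w, ((unshuffles w).map fun p => F p.1 * G p.2).sum * c w =
      (∑ᶠ u, F u * c u) * ∑ᶠ v, G v * c v := by
  classical
  set A : List α × List α → ℂ := fun p => F p.1 * G p.2 with hA
  set S := hF.toFinset ×ˢ hG.toFinset with hS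
  have hAS : ∀ p, A p ≠ 0 → p ∈ S := by
    intro p hp
    simpa [hS, hA] using hp
  set T := S.biUnion fun p => (shuffles p.1 p.2).toFinset with hT
  rw [finsum_eq_finsetSum_of_support_subset (s := T), finsum_eq_finsetSum_of_support_subset
    (s := hF.toFinset), finsum_eq_finsetSum_of_support_subset (s := hG.toFinset),
    Finset.sum_mul_sum, ← Finset.sum_product']
  · simp_rw [sum_map_unshuffles_eq hAS, Finset.sum_mul]
    rw [Finset.sum_comm]
    refine Finset.sum_congr rfl fun p hp => ?_
    have hsub : (shuffles p.1 p.2).toFinset ⊆ T := Finset.subset_biUnion_of_mem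
      (fun p : List α × List α => (shuffles p.1 p.2).toFinset) hp
    have h1 : ∑ w ∈ T, ((shuffles p.1 p.2).count w : ℂ) * c w = c p.1 * c p.2 := by
      rw [← sum_map_shuffles β hβ c_nil c_cons, Finset.sum_list_map_count]
      refine (Finset.sum_subset hsub fun w _ hw => ?_).symm.trans ?_
      · rw [List.count_eq_zero_of_not_mem (by simpa using hw)]; simp
      · simp only [nsmul_eq_mul]; congr!
    simp_rw [mul_assoc]
    rw [← Finset.mul_sum, h1]
    simp only [hA]
    ring
  · intro v hv
    simp only [Set.Finite.coe_toFinset, Function.mem_support] at hv ⊢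
    exact left_ne_zero_of_mul hv
  · intro v hv
    simp only [Set.Finite.coe_toFinset, Function.mem_support] at hv ⊢
    exact left_ne_zero_of_mul hv
  · intro w hw
    rw [Function.mem_support, sum_map_unshuffles_eq hAS] at hw
    obtain ⟨p, hp, hp'⟩ := Finset.exists_ne_zero_of_sum_ne_zero (left_ne_zero_of_mul hw)
    rw [hT, Finset.mem_coe, Finset.mem_biUnion]
    refine ⟨p, hp, ?_⟩
    rw [List.mem_toFinset, ← List.count_pos_iff, Nat.pos_iff_ne_zero]
    intro h
    simp [h] at hp'

/-- Splitting a finite sum over words according to the first letter. -/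
theorem finsum_list_eq {M : Type*} [AddCommMonoid M] [Fintype α] {F : List α → M}
    (hF : F.support.Finite) :
    ∑ᶠ l, F l = F [] + ∑ a, ∑ᶠ l, F (a :: l) := by
  classical
  have hinj : Function.Injective fun p : α × List α => p.1 :: p.2 := fun p q h => by
    simpa [Prod.ext_iff] using h
  have hcompl : Set.range (fun p : α × List α => p.1 :: p.2) = {[]}ᶜ := by
    ext l
    cases l <;> simp
  rw [← finsum_mem_univ F, ← Set.union_compl_self {([] : List α)},
    finsum_mem_union' disjoint_compl_right (hF.subset Set.inter_subset_right)
      (hF.subset Set.inter_subset_right), finsum_mem_singleton, ← hcompl, finsum_mem_range hinj,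
    finsum_curry _ (hF.preimage hinj.injOn), finsum_eq_sum_of_fintype]

end Shuffle

/-! ### Weight spaces in an associative algebra and the degree filtration -/

section WeightSpaces

variable {V A : Type*} [AddCommGroup V] [Module ℂ V] [Ring A] [Algebra ℂ A]

/-- The endomorphism `X ↦ τ(t) X - X τ(t)`. -/
def adEnd (τ : V →ₗ[ℂ] A) (t : V) : Module.End ℂ A :=
  LinearMap.mulLeft ℂ (τ t) - LinearMap.mulRight ℂ (τ t)

theorem adEnd_apply (τ : V →ₗ[ℂ] A) (t : V) (X : A) : adEnd τ t X = τ t * X - X * τ t := rfl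

/-- The space of weight `β` for the adjoint action of `τ(V)`. -/
def adWeightSpace (τ : V →ₗ[ℂ] A) (β : Dual ℂ V) : Submodule ℂ A :=
  ⨅ t, (adEnd τ t).eigenspace (β t)

theorem mem_adWeightSpace {τ : V →ₗ[ℂ] A} {β : Dual ℂ V} {X : A} :
    X ∈ adWeightSpace τ β ↔ ∀ t, τ t * X - X * τ t = β t • X := by
  simp [adWeightSpace, Submodule.mem_iInf, adEnd_apply]

/-- The sum of the weight spaces with weights in a set. -/
def adWeightSum (τ : V →ₗ[ℂ] A) (S : Set (Dual ℂ V)) : Submodule ℂ A :=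
  ⨆ β ∈ S, adWeightSpace τ β

variable {τ : V →ₗ[ℂ] A} {S T U : Set (Dual ℂ V)}

theorem adWeightSpace_le_adWeightSum {β : Dual ℂ V} (hβ : β ∈ S) :
    adWeightSpace τ β ≤ adWeightSum τ S :=
  le_biSup (adWeightSpace τ) hβ

theorem adWeightSum_le {P : Submodule ℂ A} :
    adWeightSum τ S ≤ P ↔ ∀ β ∈ S, adWeightSpace τ β ≤ P :=
  iSup₂_le_iff

theorem adWeightSum_mono (h : S ⊆ T) : adWeightSum τ S ≤ adWeightSum τ T :=
  biSup_mono h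

theorem adWeightSum_union : adWeightSum τ (S ∪ T) = adWeightSum τ S ⊔ adWeightSum τ T :=
  iSup_union

theorem mul_mem_adWeightSpace {β γ : Dual ℂ V} {X Y : A} (hX : X ∈ adWeightSpace τ β)
    (hY : Y ∈ adWeightSpace τ γ) : X * Y ∈ adWeightSpace τ (β + γ) := by
  rw [mem_adWeightSpace] at *
  intro t
  have e : τ t * (X * Y) - X * Y * τ t = (τ t * X - X * τ t) * Y + X * (τ t * Y - Y * τ t) := by
    noncomm_ring
  rw [e, hX, hY, LinearMap.add_apply, add_smul, smul_mul_assoc, mul_smul_comm]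

theorem mul_mem_adWeightSum (h : ∀ β ∈ S, ∀ γ ∈ T, β + γ ∈ U) {X Y : A}
    (hX : X ∈ adWeightSum τ S) (hY : Y ∈ adWeightSum τ T) : X * Y ∈ adWeightSum τ U := by
  have h1 : adWeightSum τ S * adWeightSum τ T ≤ adWeightSum τ U := by
    rw [adWeightSum, adWeightSum]
    simp only [Submodule.iSup_mul, Submodule.mul_iSup, iSup_le_iff]
    intro γ hγ β hβ
    rw [Submodule.mul_le]
    exact fun X hX Y hY => adWeightSpace_le_adWeightSum (h _ hβ _ hγ)
      (mul_mem_adWeightSpace hX hY)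
  exact h1 (Submodule.mul_mem_mul hX hY)

theorem one_mem_adWeightSpace : (1 : A) ∈ adWeightSpace τ 0 := by
  simp [mem_adWeightSpace]

theorem adEnd_mem_adWeightSum {X : A} (t : V) (hX : X ∈ adWeightSum τ S) :
    adEnd τ t X ∈ adWeightSum τ S := by
  suffices h : adWeightSum τ S ≤ (adWeightSum τ S).comap (adEnd τ t) from h hX
  refine adWeightSum_le.2 fun β hβ X hX => adWeightSpace_le_adWeightSum hβ ?_
  rw [adEnd_apply, mem_adWeightSpace.1 hX t]
  exact Submodule.smul_mem _ _ hX

theorem adWeightSum_le_iSup_eigenspace (t : V) :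
    adWeightSum τ S ≤ ⨆ μ ∈ (fun β : Dual ℂ V => β t) '' S, (adEnd τ t).eigenspace μ :=
  adWeightSum_le.2 fun _ hβ => (iInf_le _ t).trans
    (le_biSup (fun μ => (adEnd τ t).eigenspace μ) (Set.mem_image_of_mem _ hβ))

theorem disjoint_iSup_eigenspace (f : Module.End ℂ A) {M N : Set ℂ} (h : Disjoint M N) :
    Disjoint (⨆ μ ∈ M, f.eigenspace μ) (⨆ μ ∈ N, f.eigenspace μ) :=
  iSupIndep.disjoint_biSup_biSup f.eigenspaces_iSupIndep h

/-- Both sums lie in sums of eigenspaces of the single endomorphism `adEnd τ t`, for disjoint sets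
of eigenvalues; no diagonalizability is needed. -/
theorem disjoint_adWeightSum (t : V) (h : ∀ β ∈ S, ∀ γ ∈ T, β t ≠ γ t) :
    Disjoint (adWeightSum τ S) (adWeightSum τ T) := by
  refine Disjoint.mono (adWeightSum_le_iSup_eigenspace t) (adWeightSum_le_iSup_eigenspace t)
    (disjoint_iSup_eigenspace _ ?_)
  rw [Set.disjoint_left]
  rintro _ ⟨β, hβ, rfl⟩ ⟨γ, hγ, h'⟩
  exact h β hβ γ hγ h'.symm

theorem eq_zero_of_adEnd_eq_zero (t : V) (h : ∀ β ∈ S, β t ≠ 0) {X : A}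
    (hX : X ∈ adWeightSum τ S) (h0 : adEnd τ t X = 0) : X = 0 := by
  have hd := disjoint_iSup_eigenspace (adEnd τ t)
    (M := (fun β : Dual ℂ V => β t) '' S) (N := {0}) (by
      rw [Set.disjoint_singleton_right]
      rintro ⟨β, hβ, h'⟩
      exact h β hβ h')
  refine Submodule.disjoint_def.1 hd X (adWeightSum_le_iSup_eigenspace t hX) ?_
  simpa using h0

/-- The elements of `C` with integral value at least `k` at `t`. -/
def weightTail (C : AddSubmonoid (Dual ℂ V)) (t : V) (k : ℤ) : Set (Dual ℂ V) :=
  {β | β ∈ C ∧ ∃ n : ℤ, k ≤ n ∧ β t = n}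

/-- The elements of `C` with value `k` at `t`. -/
def weightPiece (C : AddSubmonoid (Dual ℂ V)) (t : V) (k : ℤ) : Set (Dual ℂ V) :=
  {β | β ∈ C ∧ β t = k}

variable {C C' : AddSubmonoid (Dual ℂ V)} {t : V} {j k : ℤ}

theorem weightTail_eq_union :
    weightTail C t k = weightPiece C t k ∪ weightTail C t (k + 1) := by
  ext β
  constructor
  · rintro ⟨hβ, n, hn, h⟩
    rcases hn.eq_or_lt with rfl | hn
    · exact Or.inl ⟨hβ, h⟩
    · exact Or.inr ⟨hβ, n, hn, h⟩
  · rintro (⟨hβ, h⟩ | ⟨hβ, n, hn, h⟩)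
    · exact ⟨hβ, k, le_rfl, h⟩
    · exact ⟨hβ, n, by lia, h⟩

variable (τ C t k) in
/-- The filtration by the value of the weights at `t`. -/
def adFil : Submodule ℂ A := adWeightSum τ (weightTail C t k)

theorem adFil_mono (hC : C ≤ C') (h : j ≤ k) : adFil τ C t k ≤ adFil τ C' t j :=
  adWeightSum_mono (by
    rintro _ ⟨hβ, n, hn, h'⟩
    exact ⟨hC hβ, n, h.trans hn, h'⟩)

theorem adFil_anti (h : j ≤ k) : adFil τ C t k ≤ adFil τ C t j := adFil_mono le_rfl h

theorem mul_mem_adFil {X Y : A} (hX : X ∈ adFil τ C t j) (hY : Y ∈ adFil τ C t k) :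
    X * Y ∈ adFil τ C t (j + k) :=
  mul_mem_adWeightSum (by
    rintro _ ⟨hβ, n, hn, h⟩ _ ⟨hγ, n', hn', h'⟩
    exact ⟨add_mem hβ hγ, n + n', add_le_add hn hn', by simp [h, h']⟩) hX hY

theorem one_mem_adFil : (1 : A) ∈ adFil τ C t 0 :=
  adWeightSpace_le_adWeightSum (S := weightTail C t 0)
    ⟨zero_mem _, 0, le_rfl, by simp⟩ one_mem_adWeightSpace

theorem pow_mem_adFil {X : A} (hX : X ∈ adFil τ C t k) (n : ℕ) : X ^ n ∈ adFil τ C t (n * k) := by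
  induction n with
  | zero => simpa using one_mem_adFil
  | succ n ih =>
    rw [pow_succ]
    convert mul_mem_adFil ih hX using 1
    push_cast; ring_nf

theorem adFil_eq_sup :
    adFil τ C t k = adWeightSum τ (weightPiece C t k) ⊔ adFil τ C t (k + 1) := by
  rw [adFil, weightTail_eq_union, adWeightSum_union, ← adFil]

theorem adWeightSum_weightPiece_le : adWeightSum τ (weightPiece C t k) ≤ adFil τ C t k :=
  adFil_eq_sup (τ := τ) ▸ le_sup_left

theorem disjoint_weightPiece_adFil :
    Disjoint (adWeightSum τ (weightPiece C t k)) (adFil τ C' t (k + 1)) := by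
  refine disjoint_adWeightSum t ?_
  rintro β ⟨-, hβ⟩ γ ⟨-, n, hn, hγ⟩ h
  rw [hβ, hγ] at h
  have : k = n := by exact_mod_cast h
  lia

variable (τ t) in
-- An endomorphism of a finite-dimensional space has finitely many eigenvalues, so no weight takes
-- an integral value beyond some bound at `t` unless its weight space vanishes. The bound does not
-- depend on `C`.
theorem exists_adFil_eq_bot [FiniteDimensional ℂ A] :
    ∃ K : ℕ, 0 < K ∧ ∀ C, adFil τ C t K = ⊥ := by
  have hfin : {μ : ℂ | (adEnd τ t).HasEigenvalue μ}.Finite :=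
    Module.End.finite_hasEigenvalue _
  have hfin' : {n : ℕ | (adEnd τ t).HasEigenvalue (n : ℂ)}.Finite :=
    hfin.preimage (f := fun n : ℕ => (n : ℂ)) Nat.cast_injective.injOn
  obtain ⟨K, hK⟩ := hfin'.bddAbove
  refine ⟨K + 1, by lia, fun C => ?_⟩
  rw [adFil, eq_bot_iff, adWeightSum_le]
  rintro β ⟨-, n, hn, h⟩
  refine (iInf_le _ t).trans ?_
  rw [h]
  lift n to ℕ using by lia
  rw [Int.cast_natCast]
  by_contra hne
  have : n ≤ K := hK (show (adEnd τ t).HasEigenvalue (n : ℂ) from fun h => hne h.le)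
  push_cast at hn
  lia

end WeightSpaces

/-! ### Exponentials of matrices of positive degree -/

section Exp

open scoped Nat

theorem exp_eq_sum_of_pow_eq_zero {m K : ℕ} {X : Matrix (Fin m) (Fin m) ℂ} (h : X ^ K = 0) :
    NormedSpace.exp X = ∑ n ∈ Finset.range K, (n ! : ℂ)⁻¹ • X ^ n := by
  rw [NormedSpace.exp_eq_tsum ℂ]
  refine tsum_eq_sum fun n hn => ?_
  rw [pow_eq_zero_of_le (by simpa using hn) h, smul_zero]

theorem isNilpotent_exp_eq_sum {A : Type*} [Ring A] [Algebra ℂ A] [Module ℚ A] {K : ℕ} {X : A}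
    (h : X ^ K = 0) :
    IsNilpotent.exp X = ∑ n ∈ Finset.range K, (n ! : ℂ)⁻¹ • X ^ n := by
  rw [IsNilpotent.exp_eq_sum h]
  refine Finset.sum_congr rfl fun n _ => ?_
  have : ((n ! : ℂ)⁻¹) = (((n ! : ℚ)⁻¹ : ℚ) : ℂ) := by push_cast; rfl
  rw [this, Rat.cast_smul_eq_qsmul]

/-- A subspace stable under `[X, ·]` is stable under conjugation by `exp X`, for `X` nilpotent. -/
theorem exp_mul_mul_exp_neg_mem {m : ℕ} {X : Matrix (Fin m) (Fin m) ℂ} (hX : IsNilpotent X)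
    {P : Submodule ℂ (Matrix (Fin m) (Fin m) ℂ)} (hP : ∀ Y ∈ P, X * Y - Y * X ∈ P)
    {Y : Matrix (Fin m) (Fin m) ℂ} (hY : Y ∈ P) :
    NormedSpace.exp X * Y * NormedSpace.exp (-X) ∈ P := by
  obtain ⟨K, hK⟩ := hX
  set l : Module.End ℂ (Matrix (Fin m) (Fin m) ℂ) := LinearMap.mulLeft ℂ X with hl
  set r : Module.End ℂ (Matrix (Fin m) (Fin m) ℂ) := LinearMap.mulRight ℂ (-X) with hr
  have hl' : l ^ K = 0 := by rw [hl, LinearMap.pow_mulLeft, hK, LinearMap.mulLeft_zero_eq_zero]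
  have hnX : (-X) ^ K = 0 := by rw [neg_pow, hK, mul_zero]
  have hr' : r ^ K = 0 := by rw [hr, LinearMap.pow_mulRight, hnX, LinearMap.mulRight_zero_eq_zero]
  have hc : Commute l r := LinearMap.commute_mulLeft_right _ _
  have hadd : IsNilpotent (l + r) := hc.isNilpotent_add ⟨K, hl'⟩ ⟨K, hr'⟩
  have e1 : IsNilpotent.exp l = LinearMap.mulLeft ℂ (NormedSpace.exp X) := by
    rw [isNilpotent_exp_eq_sum hl', exp_eq_sum_of_pow_eq_zero hK]
    ext1 Z
    simp [hl, Finset.sum_mul, LinearMap.pow_mulLeft]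
  have e2 : IsNilpotent.exp r = LinearMap.mulRight ℂ (NormedSpace.exp (-X)) := by
    rw [isNilpotent_exp_eq_sum hr', exp_eq_sum_of_pow_eq_zero hnX]
    ext1 Z
    simp [hr, Finset.mul_sum, LinearMap.pow_mulRight]
  -- Left and right multiplications commute, so conjugation by `exp X` is the exponential of `l + r
  -- = [X, ·]`, a polynomial in an operator that preserves `P`.
  have key : NormedSpace.exp X * Y * NormedSpace.exp (-X) = IsNilpotent.exp (l + r) Y := by
    rw [add_comm, IsNilpotent.exp_add_of_commute hc.symm ⟨K, hr'⟩ ⟨K, hl'⟩, e1, e2,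
      Module.End.mul_apply, LinearMap.mulLeft_apply, LinearMap.mulRight_apply]
  have hpow : ∀ n, ((l + r) ^ n) Y ∈ P := by
    intro n
    induction n with
    | zero => simpa using hY
    | succ n ih =>
      rw [pow_succ', Module.End.mul_apply]
      simpa [hl, hr, sub_eq_add_neg] using hP _ ih
  obtain ⟨K', hK'⟩ := hadd
  rw [key, isNilpotent_exp_eq_sum hK', LinearMap.sum_apply]
  exact Submodule.sum_mem _ fun n _ => Submodule.smul_mem _ _ (hpow n)

variable {V : Type*} [AddCommGroup V] [Module ℂ V] {m : ℕ} {τ : V →ₗ[ℂ] Matrix (Fin m) (Fin m) ℂ}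
  {C : AddSubmonoid (Dual ℂ V)} {t : V} {k : ℤ} {X : Matrix (Fin m) (Fin m) ℂ}

variable (τ t) in
theorem exists_forall_pow_eq_zero :
    ∃ K : ℕ, ∀ (C : AddSubmonoid (Dual ℂ V)), ∀ X ∈ adFil τ C t 1, X ^ K = 0 := by
  obtain ⟨K, -, hK⟩ := exists_adFil_eq_bot τ t
  refine ⟨K, fun C X hX => ?_⟩
  have := pow_mem_adFil hX K
  rwa [mul_one, hK, Submodule.mem_bot] at this

theorem exp_sub_one_sub_mem_adFil (hk : 1 ≤ k) (hX : X ∈ adFil τ C t k) :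
    NormedSpace.exp X - 1 - X ∈ adFil τ C t (k + 1) := by
  obtain ⟨K, hK⟩ := exists_forall_pow_eq_zero τ t
  -- The exponent is padded by `2` so that the terms `1` and `X` can be split off; every other term
  -- has degree at least `2 * k`, hence at least `k + 1`.
  have h0 : X ^ (K + 2) = 0 := pow_eq_zero_of_le (by lia) (hK C X (adFil_anti hk hX))
  rw [exp_eq_sum_of_pow_eq_zero h0, Finset.sum_range_succ', Finset.sum_range_succ']
  have : ∑ n ∈ Finset.range K, ((n + 1 + 1) ! : ℂ)⁻¹ • X ^ (n + 1 + 1) ∈ adFil τ C t (k + 1) :=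
    Submodule.sum_mem _ fun n _ => Submodule.smul_mem _ _
      (adFil_anti (by push_cast; nlinarith) (pow_mem_adFil hX _))
  convert this using 1
  simp

theorem exp_sub_one_mem_adFil (hk : 1 ≤ k) (hX : X ∈ adFil τ C t k) :
    NormedSpace.exp X - 1 ∈ adFil τ C t k := by
  have := add_mem (adFil_anti (by lia) (exp_sub_one_sub_mem_adFil hk hX)) hX
  simpa using this

theorem mem_adFil_zero_of_sub_one_mem {g : Matrix (Fin m) (Fin m) ℂ}
    (hg : g - 1 ∈ adFil τ C t 1) : g ∈ adFil τ C t 0 := by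
  have := add_mem (adFil_anti (by lia) hg) (one_mem_adFil (τ := τ) (C := C) (t := t))
  simpa using this

/-- Conjugation by `exp X` changes `Z` by `[X, Z]` to lowest order. -/
theorem exp_conj_sub_mem_adFil (hk : 1 ≤ k) (hX : X ∈ adFil τ C t k)
    {Z : Matrix (Fin m) (Fin m) ℂ} (hZ : Z ∈ adFil τ C t 0) :
    NormedSpace.exp X * Z * NormedSpace.exp (-X) - (Z + (X * Z - Z * X)) ∈
      adFil τ C t (k + 1) := by
  have hX' : -X ∈ adFil τ C t k := neg_mem hX
  have h1 := exp_sub_one_sub_mem_adFil hk hX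
  have h2 := exp_sub_one_sub_mem_adFil hk hX'
  set p := NormedSpace.exp X - 1 - X with hp
  set q := NormedSpace.exp (-X) - 1 - -X with hq
  have e1 : NormedSpace.exp X = 1 + X + p := by rw [hp]; abel
  have e2 : NormedSpace.exp (-X) = 1 - X + q := by rw [hq]; abel
  have hl : ∀ {Y W : Matrix (Fin m) (Fin m) ℂ}, Y ∈ adFil τ C t (k + 1) → W ∈ adFil τ C t 0 →
      Y * W ∈ adFil τ C t (k + 1) := fun hY hW => by simpa using mul_mem_adFil hY hW
  have hr : ∀ {Y W : Matrix (Fin m) (Fin m) ℂ}, Y ∈ adFil τ C t (k + 1) → W ∈ adFil τ C t 0 →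
      W * Y ∈ adFil τ C t (k + 1) := fun hY hW => by simpa using mul_mem_adFil hW hY
  have hq0 : NormedSpace.exp (-X) ∈ adFil τ C t 0 :=
    mem_adFil_zero_of_sub_one_mem (adFil_anti hk (exp_sub_one_mem_adFil hk hX'))
  have hX0 : X ∈ adFil τ C t 0 := adFil_anti (by lia) hX
  have e3 : NormedSpace.exp X * Z * NormedSpace.exp (-X) - (Z + (X * Z - Z * X)) =
      p * (Z * NormedSpace.exp (-X)) + (Z + X * Z) * q - X * (Z * X) := by
    rw [e1, e2]; noncomm_ring
  rw [e3]
  have hZ0 : Z + X * Z ∈ adFil τ C t 0 :=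
    add_mem hZ (by simpa using mul_mem_adFil hX0 hZ)
  have hXZX : X * (Z * X) ∈ adFil τ C t (k + 1) := by
    have := mul_mem_adFil hX (mul_mem_adFil hZ hX)
    exact adFil_anti (by lia) this
  exact sub_mem (add_mem (hl h1 (by simpa using mul_mem_adFil hZ hq0)) (hr h2 hZ0)) hXZX

end Exp

/-! ### Root spaces, heights and homogeneous components -/

section RootSpaces

variable {𝔤 : Type*} [LieRing 𝔤] [LieAlgebra ℂ 𝔤] {𝔱 : LieSubalgebra ℂ 𝔤} {m : ℕ}

/-- The restriction to `𝔱` of a matrix representation of `𝔤`. -/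
def cartanRep (𝔱 : LieSubalgebra ℂ 𝔤) (ρ : 𝔤 →ₗ⁅ℂ⁆ Matrix (Fin m) (Fin m) ℂ) :
    𝔱 →ₗ[ℂ] Matrix (Fin m) (Fin m) ℂ :=
  (ρ : 𝔤 →ₗ[ℂ] Matrix (Fin m) (Fin m) ℂ) ∘ₗ 𝔱.toSubmodule.subtype

@[simp]
theorem cartanRep_apply (ρ : 𝔤 →ₗ⁅ℂ⁆ Matrix (Fin m) (Fin m) ℂ) (t : 𝔱) :
    cartanRep 𝔱 ρ t = ρ (t : 𝔤) := rfl

theorem map_lie_eq_sub (ρ : 𝔤 →ₗ⁅ℂ⁆ Matrix (Fin m) (Fin m) ℂ) (y z : 𝔤) :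
    ρ ⁅y, z⁆ = ρ y * ρ z - ρ z * ρ y := by
  rw [LieHom.map_lie, Ring.lie_def]

variable [FiniteDimensional ℂ 𝔤] [LieAlgebra.IsSimple ℂ 𝔤] [𝔱.IsCartanSubalgebra]

/-- A weight as a linear form. -/
abbrev weightForm (γ : LieModule.Weight ℂ 𝔱 𝔤) : Dual ℂ 𝔱 := LieModule.Weight.toLinear ℂ 𝔱 𝔤 γ

theorem map_mem_adWeightSpace (ρ : 𝔤 →ₗ⁅ℂ⁆ Matrix (Fin m) (Fin m) ℂ)
    {γ : LieModule.Weight ℂ 𝔱 𝔤} {y : 𝔤} (hy : y ∈ rootSpace 𝔱 γ) :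
    ρ y ∈ adWeightSpace (cartanRep 𝔱 ρ) (weightForm γ) := by
  rw [mem_adWeightSpace]
  intro t
  have h : ⁅(t : 𝔤), y⁆ = γ t • y := lie_eq_smul_of_mem_rootSpace hy t
  rw [cartanRep_apply, ← map_lie_eq_sub, h, map_smul]
  rfl

variable (b : (rootSystem 𝔱).Base)

/-- The element of `𝔱` where all simple roots take the value `1`. -/
def heightElement : 𝔱 :=
  (Module.evalEquiv ℂ 𝔱).symm (b.toWeightBasis.constr ℂ fun _ => (1 : ℂ))

theorem apply_heightElement (β : Dual ℂ 𝔱) :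
    β (heightElement b) = b.toWeightBasis.constr ℂ (fun _ => (1 : ℂ)) β := by
  rw [heightElement, Module.apply_evalEquiv_symm_apply]

theorem root_heightElement (α : 𝔱.root) :
    (rootSystem 𝔱).root α (heightElement b) = b.height α := by
  obtain ⟨f, -, -, hf⟩ := b.exists_root_eq_sum_int α
  have h1 : ∀ j ∈ b.support, (rootSystem 𝔱).root j (heightElement b) = 1 := by
    intro j hj
    have := b.toWeightBasis.constr_basis ℂ (fun _ => (1 : ℂ)) ⟨j, hj⟩
    rwa [b.toWeightBasis_apply, ← apply_heightElement] at this
  rw [b.height_eq_sum hf, hf, LinearMap.sum_apply]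
  push_cast
  refine Finset.sum_congr rfl fun j hj => ?_
  rw [LinearMap.smul_apply, h1 j hj]
  simp

theorem weight_isZero_or_exists_root (γ : LieModule.Weight ℂ 𝔱 𝔤) :
    weightForm γ = 0 ∨ ∃ α : 𝔱.root, (rootSystem 𝔱).root α = weightForm γ := by
  by_cases h : γ.IsZero
  · left
    ext t
    exact congrFun h t
  · exact Or.inr ⟨⟨γ, by simpa using h⟩, rfl⟩

theorem exists_int_weight_heightElement (γ : LieModule.Weight ℂ 𝔱 𝔤) :
    ∃ n : ℤ, weightForm γ (heightElement b) = n := by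
  rcases weight_isZero_or_exists_root γ with h | ⟨α, h⟩
  · exact ⟨0, by simp [h]⟩
  · exact ⟨b.height α, by rw [← h, root_heightElement]⟩

theorem root_mem_weightTail {α : 𝔱.root} (hα : b.IsPos α) :
    (rootSystem 𝔱).root α ∈ weightTail (rootCone b) (heightElement b) 1 :=
  ⟨AddSubmonoid.subset_closure ⟨α, hα, rfl⟩, b.height α, hα, root_heightElement b α⟩

/-- The filtration of the matrix algebra by the value of the weights at `heightElement b`. -/
abbrev heightFil (ρ : 𝔤 →ₗ⁅ℂ⁆ Matrix (Fin m) (Fin m) ℂ) (C : AddSubmonoid (Dual ℂ 𝔱)) (k : ℤ) :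
    Submodule ℂ (Matrix (Fin m) (Fin m) ℂ) :=
  adFil (cartanRep 𝔱 ρ) C (heightElement b) k

theorem map_mem_heightFil (ρ : 𝔤 →ₗ⁅ℂ⁆ Matrix (Fin m) (Fin m) ℂ) {a : 𝔤}
    (ha : a ∈ nilpotentPart b) : ρ a ∈ heightFil b ρ (rootCone b) 1 := by
  have h : (nilpotentPart b).toSubmodule ≤
      (heightFil b ρ (rootCone b) 1).comap (ρ : 𝔤 →ₗ[ℂ] Matrix (Fin m) (Fin m) ℂ) := by
    refine iSup_le fun γ y hy => ?_
    exact adWeightSpace_le_adWeightSum (root_mem_weightTail b γ.2) (map_mem_adWeightSpace ρ hy)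
  exact h ha

variable (𝔱) in
-- The root spaces, including the zero weight space, span `𝔤`, so the sum map from their product has
-- a linear section. Linearity is what later keeps components of a regular family regular.
theorem exists_weight_projections :
    ∃ P : LieModule.Weight ℂ 𝔱 𝔤 → 𝔤 →ₗ[ℂ] 𝔤,
      (∀ (γ : LieModule.Weight ℂ 𝔱 𝔤) y, P γ y ∈ rootSpace 𝔱 γ) ∧ ∀ y, ∑ γ, P γ y = y := by
  classical
  set p : LieModule.Weight ℂ 𝔱 𝔤 → Submodule ℂ 𝔤 := fun γ => (rootSpace 𝔱 γ).toSubmodule with hp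
  have htop : iSup p = ⊤ := by
    have := LieModule.iSup_genWeightSpace_eq_top' ℂ 𝔱 𝔤
    rw [← LieSubmodule.toSubmodule_inj, LieSubmodule.iSup_toSubmodule] at this
    exact this
  set F : ((γ : LieModule.Weight ℂ 𝔱 𝔤) → p γ) →ₗ[ℂ] 𝔤 :=
    ∑ γ, (p γ).subtype ∘ₗ LinearMap.proj γ with hF
  have hsurj : LinearMap.range F = ⊤ := by
    rw [eq_top_iff, ← htop, iSup_le_iff]
    intro γ y hy
    refine ⟨Pi.single γ ⟨y, hy⟩, ?_⟩
    rw [hF, LinearMap.sum_apply, Finset.sum_eq_single_of_mem γ (Finset.mem_univ _)]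
    · simp
    · intro γ' _ h
      simp [Pi.single_eq_of_ne h]
  obtain ⟨s, hs⟩ := F.exists_rightInverse_of_surjective hsurj
  refine ⟨fun γ => (p γ).subtype ∘ₗ LinearMap.proj γ ∘ₗ s, fun γ y => (s y γ).2, fun y => ?_⟩
  have := LinearMap.congr_fun hs y
  simpa [hF] using this

/-- A projection onto the root space of `γ`. -/
def weightProj (γ : LieModule.Weight ℂ 𝔱 𝔤) : 𝔤 →ₗ[ℂ] 𝔤 :=
  (exists_weight_projections 𝔱).choose γ

theorem weightProj_mem (γ : LieModule.Weight ℂ 𝔱 𝔤) (y : 𝔤) : weightProj γ y ∈ rootSpace 𝔱 γ :=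
  (exists_weight_projections 𝔱).choose_spec.1 γ y

variable (𝔱) in
theorem sum_weightProj (y : 𝔤) : ∑ γ : LieModule.Weight ℂ 𝔱 𝔤, weightProj γ y = y :=
  (exists_weight_projections 𝔱).choose_spec.2 y

open Classical in
/-- The weights taking the value `k` at `heightElement b`. -/
def degreeWeights (k : ℤ) : Finset (LieModule.Weight ℂ 𝔱 𝔤) :=
  {γ | weightForm γ (heightElement b) = k}

theorem mem_degreeWeights {k : ℤ} {γ : LieModule.Weight ℂ 𝔱 𝔤} :
    γ ∈ degreeWeights b k ↔ weightForm γ (heightElement b) = k := by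
  simp [degreeWeights]

theorem exists_isPos_of_mem_degreeWeights {k : ℤ} (hk : 1 ≤ k) {γ : LieModule.Weight ℂ 𝔱 𝔤}
    (hγ : γ ∈ degreeWeights b k) :
    ∃ α : 𝔱.root, b.IsPos α ∧ α = γ ∧ (rootSystem 𝔱).root α = weightForm γ := by
  rw [mem_degreeWeights] at hγ
  have h0 : ¬ γ.IsZero := by
    intro h
    have : weightForm γ (heightElement b) = 0 := congrFun h _
    rw [this] at hγ
    have : (0 : ℤ) = k := by exact_mod_cast hγ
    lia
  let α : 𝔱.root := ⟨γ, by simpa using h0⟩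
  refine ⟨α, ?_, rfl, rfl⟩
  have h1 : (b.height α : ℂ) = k := (root_heightElement b α).symm.trans hγ
  have h2 : b.height α = k := by exact_mod_cast h1
  rw [RootPairing.Base.isPos_iff, h2]
  lia

/-- The component of degree `k`. -/
def degreePart (k : ℤ) (y : 𝔤) : 𝔤 := ∑ γ ∈ degreeWeights b k, weightProj γ y

theorem sum_smul_weightProj_mem {k : ℤ} (hk : 1 ≤ k) (c : LieModule.Weight ℂ 𝔱 𝔤 → ℂ) (y : 𝔤) :
    ∑ γ ∈ degreeWeights b k, c γ • weightProj γ y ∈ nilpotentPart b := by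
  refine sum_mem fun γ hγ => ?_
  obtain ⟨α, hα, rfl, -⟩ := exists_isPos_of_mem_degreeWeights b hk hγ
  exact (nilpotentPart b).smul_mem _ (Submodule.mem_iSup_of_mem
    (⟨α, hα⟩ : {γ : 𝔱.root // b.IsPos γ}) (weightProj_mem _ y))

variable (ρ : 𝔤 →ₗ⁅ℂ⁆ Matrix (Fin m) (Fin m) ℂ)

theorem map_sum_weightProj_mem {s : Finset (LieModule.Weight ℂ 𝔱 𝔤)} {S : Set (Dual ℂ 𝔱)}
    (hs : ∀ γ ∈ s, weightForm γ ∈ S) (c : LieModule.Weight ℂ 𝔱 𝔤 → ℂ) (y : 𝔤) :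
    ρ (∑ γ ∈ s, c γ • weightProj γ y) ∈ adWeightSum (cartanRep 𝔱 ρ) S := by
  rw [map_sum]
  refine sum_mem fun γ hγ => ?_
  rw [map_smul]
  exact Submodule.smul_mem _ _ (adWeightSpace_le_adWeightSum (hs γ hγ)
    (map_mem_adWeightSpace ρ (weightProj_mem γ y)))

theorem map_degreePart_mem (k : ℤ) (y : 𝔤) :
    ρ (degreePart b k y) ∈
      adWeightSum (cartanRep 𝔱 ρ) (weightPiece ⊤ (heightElement b) k) := by
  have := map_sum_weightProj_mem ρ (s := degreeWeights b k)
    (S := weightPiece ⊤ (heightElement b) k)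
    (fun γ hγ => ⟨trivial, (mem_degreeWeights b).1 hγ⟩) (fun _ => 1) y
  simpa [degreePart] using this

theorem map_sub_degreePart_mem (k : ℤ) (y : 𝔤) :
    ρ (y - degreePart b k y) ∈
      adWeightSum (cartanRep 𝔱 ρ) {β | β (heightElement b) ≠ k} := by
  classical
  have h := map_sum_weightProj_mem ρ (s := (degreeWeights b k)ᶜ)
    (S := {β | β (heightElement b) ≠ k})
    (fun γ hγ => by simpa [mem_degreeWeights] using hγ) (fun _ => 1) y
  have e : y - degreePart b k y = ∑ γ ∈ (degreeWeights b k)ᶜ, (1 : ℂ) • weightProj γ y := by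
    rw [sub_eq_iff_eq_add, degreePart]
    simp only [one_smul]
    rw [add_comm, Finset.sum_add_sum_compl, sum_weightProj]
  rwa [e]

/-- The matrix `ρ y` also splits as `ρ` of its degree `k` part plus terms of other degrees, and the
two splittings agree by disjointness. It serves to show that a homogeneous component found inside
the matrix algebra belongs to `ρ(𝔤)`. -/
theorem eq_map_degreePart_of_add_mem {k : ℤ} {y : 𝔤} {X E : Matrix (Fin m) (Fin m) ℂ}
    (hX : X ∈ adWeightSum (cartanRep 𝔱 ρ) (weightPiece ⊤ (heightElement b) k))
    (hE : E ∈ adWeightSum (cartanRep 𝔱 ρ) {β | β (heightElement b) ≠ k})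
    (h : ρ y = X + E) : X = ρ (degreePart b k y) := by
  have hd : Disjoint (adWeightSum (cartanRep 𝔱 ρ) (weightPiece ⊤ (heightElement b) k))
      (adWeightSum (cartanRep 𝔱 ρ) {β | β (heightElement b) ≠ k}) :=
    disjoint_adWeightSum (heightElement b) fun β hβ γ hγ h => hγ (h ▸ hβ.2)
  rw [← sub_eq_zero]
  refine Submodule.disjoint_def.1 hd _ (sub_mem hX (map_degreePart_mem b ρ k y)) ?_
  have e : X - ρ (degreePart b k y) = ρ (y - degreePart b k y) - E := by
    rw [map_sub, h]; abel
  rw [e]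
  exact sub_mem (map_sub_degreePart_mem b ρ k y) hE

theorem heightFil_succ_le (k : ℤ) :
    heightFil b ρ ⊤ (k + 1) ≤ adWeightSum (cartanRep 𝔱 ρ) {β | β (heightElement b) ≠ k} := by
  refine adWeightSum_mono ?_
  rintro β ⟨-, n, hn, h⟩ h'
  rw [h] at h'
  have : n = k := by exact_mod_cast h'
  lia

theorem sub_map_degreePart_mem_heightFil {k : ℤ} {y : 𝔤} (hy : ρ y ∈ heightFil b ρ ⊤ k) :
    ρ y - ρ (degreePart b k y) ∈ heightFil b ρ ⊤ (k + 1) := by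
  rw [heightFil, adFil_eq_sup] at hy
  obtain ⟨X, hX, E, hE, h⟩ := Submodule.mem_sup.1 hy
  rw [← eq_map_degreePart_of_add_mem b ρ hX (heightFil_succ_le b ρ k hE) h.symm, ← h]
  simpa using hE

end RootSpaces

/-! ### The unipotent group: normalization of `𝔤` and uniqueness of `n_x` -/

section UnipotentGroup

variable {𝔤 : Type*} [LieRing 𝔤] [LieAlgebra ℂ 𝔤] [FiniteDimensional ℂ 𝔤] [LieAlgebra.IsSimple ℂ 𝔤]
  {𝔱 : LieSubalgebra ℂ 𝔤} [𝔱.IsCartanSubalgebra] {m : ℕ}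
  (b : (rootSystem 𝔱).Base) (ρ : 𝔤 →ₗ⁅ℂ⁆ Matrix (Fin m) (Fin m) ℂ)

theorem coe_expGL (X : Matrix (Fin m) (Fin m) ℂ) :
    (expGL X : Matrix (Fin m) (Fin m) ℂ) = NormedSpace.exp X := rfl

theorem expGL_inv (X : Matrix (Fin m) (Fin m) ℂ) : (expGL X)⁻¹ = expGL (-X) := by
  rw [inv_eq_iff_mul_eq_one]
  ext1
  rw [Units.val_mul, coe_expGL, coe_expGL,
    ← Matrix.exp_add_of_commute _ _ (Commute.refl X).neg_right,
    add_neg_cancel, NormedSpace.exp_zero, Units.val_one]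

variable {b ρ} in
theorem unipotentGroup_induction {P : GL (Fin m) ℂ → Prop}
    (exp : ∀ a ∈ nilpotentPart b, P (expGL (ρ a))) (one : P 1)
    (mul : ∀ g h, P g → P h → P (g * h)) {g : GL (Fin m) ℂ} (hg : g ∈ unipotentGroup b ρ) :
    P g := by
  -- The pair of claims is stable under inversion, and it holds for exponentials because `(exp a)⁻¹
  -- = exp (-a)`.
  suffices h : P g ∧ P g⁻¹ from h.1
  induction hg using Subgroup.closure_induction with
  | mem g h =>
    obtain ⟨a, rfl⟩ := h
    refine ⟨exp a a.2, ?_⟩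
    have := exp (-a) (neg_mem a.2)
    rwa [map_neg, ← expGL_inv] at this
  | one => exact ⟨one, by rwa [inv_one]⟩
  | mul g h _ _ hg hh => exact ⟨mul _ _ hg.1 hh.1, by rw [mul_inv_rev]; exact mul _ _ hh.2 hg.2⟩
  | inv g _ hg => exact ⟨hg.2, by rw [inv_inv]; exact hg.1⟩

theorem sub_one_mem_of_mem_unipotentGroup {g : GL (Fin m) ℂ} (hg : g ∈ unipotentGroup b ρ) :
    (g : Matrix (Fin m) (Fin m) ℂ) - 1 ∈ heightFil b ρ (rootCone b) 1 := by
  refine unipotentGroup_induction (P := fun g => (g : Matrix (Fin m) (Fin m) ℂ) - 1 ∈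
    heightFil b ρ (rootCone b) 1) (fun a ha => ?_) (by simp) (fun g h hg hh => ?_) hg
  · rw [coe_expGL]
    exact exp_sub_one_mem_adFil le_rfl (map_mem_heightFil b ρ ha)
  · have e : ((g * h : GL (Fin m) ℂ) : Matrix (Fin m) (Fin m) ℂ) - 1 =
        ((g : Matrix (Fin m) (Fin m) ℂ) - 1) * h + ((h : Matrix (Fin m) (Fin m) ℂ) - 1) := by
      rw [Units.val_mul]; noncomm_ring
    rw [e]
    refine add_mem ?_ hh
    simpa using mul_mem_adFil hg (mem_adFil_zero_of_sub_one_mem hh)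

theorem isNilpotent_map {a : 𝔤} (ha : a ∈ nilpotentPart b) : IsNilpotent (ρ a) := by
  obtain ⟨K, hK⟩ := exists_forall_pow_eq_zero (cartanRep 𝔱 ρ) (heightElement b)
  exact ⟨K, hK _ _ (map_mem_heightFil b ρ ha)⟩

/-- The subspace `ρ(𝔤)` is stable under bracketing with `ρ a`, hence under conjugation by `exp (ρ
a)`, and these exponentials generate the group. -/
theorem exists_conj_eq_of_mem_unipotentGroup {g : GL (Fin m) ℂ} (hg : g ∈ unipotentGroup b ρ)
    (y : 𝔤) : ∃ z : 𝔤, (g : Matrix (Fin m) (Fin m) ℂ) * ρ y *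
      ((g⁻¹ : GL (Fin m) ℂ) : Matrix (Fin m) (Fin m) ℂ) = ρ z := by
  revert y
  refine unipotentGroup_induction (P := fun g => ∀ y : 𝔤, ∃ z : 𝔤,
    (g : Matrix (Fin m) (Fin m) ℂ) * ρ y * ((g⁻¹ : GL (Fin m) ℂ) : Matrix (Fin m) (Fin m) ℂ) = ρ z)
    (fun a ha y => ?_) (fun y => ⟨y, by simp⟩) (fun g h hg hh y => ?_) hg
  · have := exp_mul_mul_exp_neg_mem (isNilpotent_map b ρ ha)
      (P := LinearMap.range (ρ : 𝔤 →ₗ[ℂ] Matrix (Fin m) (Fin m) ℂ))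
      (by rintro _ ⟨z, rfl⟩; exact ⟨⁅a, z⁆, map_lie_eq_sub ρ a z⟩) (Y := ρ y) ⟨y, rfl⟩
    obtain ⟨z, hz⟩ := this
    exact ⟨z, by rw [expGL_inv, coe_expGL, coe_expGL]; exact hz.symm⟩
  · obtain ⟨z, hz⟩ := hh y
    obtain ⟨w, hw⟩ := hg z
    refine ⟨w, ?_⟩
    rw [← hw, ← hz, mul_inv_rev, Units.val_mul, Units.val_mul]
    noncomm_ring

/-- A matrix of positive degree `k` normalizing `ρ(𝔤)` lies in `ρ(𝔤)`, since all derivations of `𝔤` are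
inner. -/
theorem exists_eq_map_of_forall_commutator (hρ : Function.Injective ρ) {k : ℤ} (hk : 1 ≤ k)
    {X : Matrix (Fin m) (Fin m) ℂ}
    (hX : X ∈ adWeightSum (cartanRep 𝔱 ρ) (weightPiece ⊤ (heightElement b) k))
    (h : ∀ y, ∃ z, X * ρ y - ρ y * X = ρ z) : ∃ y, X = ρ (degreePart b k y) := by
  choose d hd using h
  -- The map `d` is chosen pointwise; as `ρ` is injective and `[X, ·]` is a derivation, `d` is one
  -- too.
  let D : LieDerivation ℂ 𝔤 𝔤 :=
    { toFun := d
      map_add' := fun y z => hρ (by rw [← hd, map_add, map_add, ← hd, ← hd]; noncomm_ring)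
      map_smul' := fun c y => hρ (by
        rw [← hd, map_smul, RingHom.id_apply, map_smul, ← hd, mul_smul_comm, smul_mul_assoc,
          smul_sub])
      leibniz' := fun y z => hρ (by
        change ρ (d ⁅y, z⁆) = ρ (⁅y, d z⁆ - ⁅z, d y⁆)
        rw [← hd, map_sub, map_lie_eq_sub, map_lie_eq_sub, map_lie_eq_sub, ← hd, ← hd]
        noncomm_ring) }
  obtain ⟨y, hy⟩ := LieDerivation.IsKilling.exists_eq_ad D
  have hy' : ∀ z, X * ρ z - ρ z * X = ρ ⁅y, z⁆ := fun z => by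
    have : ⁅y, z⁆ = d z := by
      rw [← LieDerivation.ad_apply_apply (R := ℂ), hy]; rfl
    rw [this, hd]
  -- The difference `ρ y - X` commutes with `ρ(𝔱)`, so it has weight zero and no component of degree
  -- `k ≥ 1`: thus `X` is the degree `k` part of `ρ y`.
  refine ⟨y, eq_map_degreePart_of_add_mem b ρ hX (E := ρ y - X) ?_ (by abel)⟩
  have h0 : ρ y - X ∈ adWeightSpace (cartanRep 𝔱 ρ) 0 := by
    rw [mem_adWeightSpace]
    intro t
    have h1 := hy' t
    rw [map_lie_eq_sub] at h1
    rw [cartanRep_apply, LinearMap.zero_apply, zero_smul, mul_sub, sub_mul]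
    have : ρ (t : 𝔤) * ρ y - ρ (t : 𝔤) * X - (ρ y * ρ (t : 𝔤) - X * ρ (t : 𝔤)) =
      (X * ρ (t : 𝔤) - ρ (t : 𝔤) * X) - (ρ y * ρ (t : 𝔤) - ρ (t : 𝔤) * ρ y) := by abel
    rw [this, h1, sub_self]
  refine adWeightSpace_le_adWeightSum (S := {β | β (heightElement b) ≠ k}) ?_ h0
  intro h
  rw [LinearMap.zero_apply] at h
  have : (0 : ℤ) = k := by exact_mod_cast h
  lia

/-- The leading term of `g - 1` normalizes `ρ(𝔤)` if `g` does. -/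
theorem forall_exists_commutator_eq {g g' X Z : Matrix (Fin m) (Fin m) ℂ} {k : ℤ}
    (hgg' : g * g' = 1) (hg' : g' - 1 ∈ heightFil b ρ ⊤ 1)
    (hX : X ∈ adWeightSum (cartanRep 𝔱 ρ) (weightPiece ⊤ (heightElement b) k))
    (hZ : Z ∈ heightFil b ρ ⊤ (k + 1)) (hg : g - 1 = X + Z)
    (h : ∀ y, ∃ z, g * ρ y * g' = ρ z) (y : 𝔤) : ∃ z, X * ρ y - ρ y * X = ρ z := by
  have hweight : ∀ (γ : LieModule.Weight ℂ 𝔱 𝔤) (y : 𝔤), y ∈ rootSpace 𝔱 γ →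
      ∃ z, X * ρ y - ρ y * X = ρ z := by
    intro γ y hy
    obtain ⟨j, hj⟩ := exists_int_weight_heightElement b γ
    have hy1 := map_mem_adWeightSpace ρ hy
    have hyp : ρ y ∈ adWeightSum (cartanRep 𝔱 ρ) (weightPiece ⊤ (heightElement b) j) :=
      adWeightSpace_le_adWeightSum (S := weightPiece ⊤ (heightElement b) j) ⟨trivial, hj⟩ hy1
    have hyf : ρ y ∈ heightFil b ρ ⊤ j := adWeightSum_weightPiece_le hyp
    obtain ⟨z, hz⟩ := h y
    have hC : X * ρ y - ρ y * X ∈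
        adWeightSum (cartanRep 𝔱 ρ) (weightPiece ⊤ (heightElement b) (k + j)) := by
      refine sub_mem (mul_mem_adWeightSum ?_ hX hyp) (mul_mem_adWeightSum ?_ hyp hX)
      · rintro β ⟨-, hβ⟩ γ ⟨-, hγ⟩
        exact ⟨trivial, by simp [hβ, hγ]⟩
      · rintro β ⟨-, hβ⟩ γ ⟨-, hγ⟩
        exact ⟨trivial, by simp [hβ, hγ, add_comm]⟩
    -- From `g * ρ y * g' - ρ y = [g - 1, ρ y] * g'`, the component of degree `k + j` is `[X, ρ y]`
    -- and the rest has higher degree.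
    refine ⟨_, eq_map_degreePart_of_add_mem b ρ hC (y := z - y)
      (E := (X * ρ y - ρ y * X) * (g' - 1) + (Z * ρ y - ρ y * Z) * g') ?_ ?_⟩
    · refine heightFil_succ_le b ρ _
        (add_mem (mul_mem_adFil (adWeightSum_weightPiece_le hC) hg') ?_)
      have h1 : Z * ρ y - ρ y * Z ∈ heightFil b ρ ⊤ (k + j + 1) :=
        sub_mem (adFil_anti (by lia) (mul_mem_adFil hZ hyf))
          (adFil_anti (by lia) (mul_mem_adFil hyf hZ))
      simpa using mul_mem_adFil h1 (mem_adFil_zero_of_sub_one_mem hg')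
    · have e : g = 1 + X + Z := by rw [add_assoc, ← hg]; abel
      rw [map_sub, ← hz]
      have e2 : ρ y = ρ y * (g * g') := by rw [hgg', mul_one]
      nth_rewrite 2 [e2]
      rw [e]
      noncomm_ring
  have hsum := sum_weightProj 𝔱 y
  choose z hz using fun γ : LieModule.Weight ℂ 𝔱 𝔤 => hweight γ _ (weightProj_mem γ y)
  refine ⟨∑ γ, z γ, ?_⟩
  rw [← hsum, map_sum, Finset.mul_sum, Finset.sum_mul, ← Finset.sum_sub_distrib, map_sum]
  exact Finset.sum_congr rfl fun γ _ => hz γ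

/-- The leading term `X` of `g - 1` lies in `ρ(𝔫)`, even though `g - 1` need not. Its weights are
therefore positive roots, nonzero at `x`, and `[x, X] = 0` forces `X = 0`; so the degree of `g - 1`
can be raised indefinitely. -/
theorem eq_one_of_commute (hρ : Function.Injective ρ) (x : RegularElement 𝔱) {g : GL (Fin m) ℂ}
    (hg : g ∈ unipotentGroup b ρ)
    (hc : (g : Matrix (Fin m) (Fin m) ℂ) * ρ (x.1 : 𝔤) = ρ (x.1 : 𝔤) * g) : g = 1 := by
  have hle : heightFil b ρ (rootCone b) 1 ≤ heightFil b ρ ⊤ 1 := adFil_mono le_top le_rfl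
  have hmem : ∀ k : ℕ, (g : Matrix (Fin m) (Fin m) ℂ) - 1 ∈ heightFil b ρ ⊤ (k + 1) := by
    intro k
    induction k with
    | zero => simpa using hle (sub_one_mem_of_mem_unipotentGroup b ρ hg)
    | succ k ih =>
      have hk : (1 : ℤ) ≤ k + 1 := by lia
      rw [heightFil, adFil_eq_sup] at ih
      obtain ⟨X, hX, Z, hZ, h⟩ := Submodule.mem_sup.1 ih
      obtain ⟨y, hy⟩ := exists_eq_map_of_forall_commutator b ρ hρ hk hX
        (forall_exists_commutator_eq b ρ (by simp)
          (hle (sub_one_mem_of_mem_unipotentGroup b ρ (inv_mem hg))) hX hZ h.symm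
          (exists_conj_eq_of_mem_unipotentGroup b ρ hg))
      have hgx : adEnd (cartanRep 𝔱 ρ) x.1 X + adEnd (cartanRep 𝔱 ρ) x.1 Z = 0 := by
        rw [← map_add, h, adEnd_apply, cartanRep_apply, mul_sub, sub_mul, hc]
        simp
      -- Bracketing with `x` preserves degrees, so `[x, X]` and `[x, Z]` cannot cancel.
      have hX0 : adEnd (cartanRep 𝔱 ρ) x.1 X = 0 := by
        refine Submodule.disjoint_def.1 (disjoint_weightPiece_adFil (C' := ⊤)) _
          (adEnd_mem_adWeightSum x.1 hX) ?_
        rw [eq_neg_of_add_eq_zero_left hgx]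
        exact neg_mem (adEnd_mem_adWeightSum x.1 hZ)
      have hX' : X ∈ adWeightSum (cartanRep 𝔱 ρ)
          {β | ∃ γ ∈ degreeWeights b (k + 1), β = weightForm γ} := by
        have := map_sum_weightProj_mem ρ (s := degreeWeights b (k + 1))
          (S := {β | ∃ γ ∈ degreeWeights b (k + 1), β = weightForm γ})
          (fun γ hγ => ⟨γ, hγ, rfl⟩) (fun _ => 1) y
        rw [hy]
        simpa [degreePart] using this
      have hzero : X = 0 := by
        refine eq_zero_of_adEnd_eq_zero x.1 ?_ hX' hX0
        rintro _ ⟨γ, hγ, rfl⟩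
        obtain ⟨α, -, -, hα⟩ := exists_isPos_of_mem_degreeWeights b hk hγ
        rw [← hα]
        exact x.2 α
      rw [← h, hzero, zero_add]
      exact_mod_cast hZ
  obtain ⟨K, -, hK⟩ := exists_adFil_eq_bot (cartanRep 𝔱 ρ) (heightElement b)
  have := adFil_anti (by lia) (hmem K) (j := K)
  rw [hK, Submodule.mem_bot, sub_eq_zero] at this
  exact Units.ext this

/-- There is at most one element of the unipotent group conjugating a regular element `x` to a given
element. -/
theorem eq_of_AdEq (hρ : Function.Injective ρ) (x : RegularElement 𝔱) {z : 𝔤}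
    {g g' : unipotentGroup b ρ} (h : AdEq ρ g (x.1 : 𝔤) z) (h' : AdEq ρ g' (x.1 : 𝔤) z) :
    g = g' := by
  have h1 : (g'⁻¹ * g : unipotentGroup b ρ) = 1 := by
    apply Subtype.ext
    refine eq_one_of_commute b ρ hρ x (g'⁻¹ * g).2 ?_
    have e := h.trans h'.symm
    have e1 : ((g : GL (Fin m) ℂ) : Matrix (Fin m) (Fin m) ℂ) * ρ (x.1 : 𝔤) =
        ((g' : GL (Fin m) ℂ) : Matrix (Fin m) (Fin m) ℂ) * ρ (x.1 : 𝔤) *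
          (((g' : GL (Fin m) ℂ)⁻¹ : GL (Fin m) ℂ) : Matrix (Fin m) (Fin m) ℂ) *
          ((g : GL (Fin m) ℂ) : Matrix (Fin m) (Fin m) ℂ) := by
      rw [← e, mul_assoc, Units.inv_mul, mul_one]
    rw [Subgroup.coe_mul, Subgroup.coe_inv, Units.val_mul, mul_assoc, e1]
    simp only [← mul_assoc, Units.inv_mul, one_mul]
  exact (inv_mul_eq_one.1 h1).symm

end UnipotentGroup

/-! ### Matrices depending regularly on `x` -/

section RegularMatrices

variable {𝔤 : Type*} [LieRing 𝔤] [LieAlgebra ℂ 𝔤] [FiniteDimensional ℂ 𝔤] [LieAlgebra.IsSimple ℂ 𝔤]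
  (𝔱 : LieSubalgebra ℂ 𝔤) [𝔱.IsCartanSubalgebra] (m : ℕ)

/-- The algebra of matrices of regular functions on `𝔱^reg`. -/
def regularMatrices : Subalgebra ℂ (RegularElement 𝔱 → Matrix (Fin m) (Fin m) ℂ) where
  carrier := {F | ∀ i j, (fun x => F x i j) ∈ regularFunctions 𝔱}
  mul_mem' {F G} hF hG i j := by
    have : (fun x => (F * G) x i j) = ∑ k, (fun x => F x i k) * fun x => G x k j := by
      ext x
      simp [Matrix.mul_apply]
    rw [this]
    exact sum_mem fun k _ => mul_mem (hF i k) (hG k j)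
  add_mem' hF hG i j := add_mem (hF i j) (hG i j)
  algebraMap_mem' r i j := by
    have : (fun x => (algebraMap ℂ (RegularElement 𝔱 → Matrix (Fin m) (Fin m) ℂ) r) x i j) =
        algebraMap ℂ (RegularElement 𝔱 → ℂ) (if i = j then r else 0) := by
      ext x
      simp [Pi.algebraMap_apply, Matrix.algebraMap_matrix_apply]
    rw [this]
    exact Subalgebra.algebraMap_mem _ _

variable {𝔱 m} {F : RegularElement 𝔱 → Matrix (Fin m) (Fin m) ℂ}

theorem const_mem_regularMatrices (X : Matrix (Fin m) (Fin m) ℂ) :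
    (fun _ => X) ∈ regularMatrices 𝔱 m := fun i j =>
  Subalgebra.algebraMap_mem (regularFunctions 𝔱) (X i j)

theorem smul_mem_regularMatrices {c : RegularElement 𝔱 → ℂ} (hc : c ∈ regularFunctions 𝔱)
    (hF : F ∈ regularMatrices 𝔱 m) : (fun x => c x • F x) ∈ regularMatrices 𝔱 m :=
  fun i j => mul_mem hc (hF i j)

theorem linear_mem_regularMatrices
    (L : Matrix (Fin m) (Fin m) ℂ →ₗ[ℂ] Matrix (Fin m) (Fin m) ℂ)
    (hF : F ∈ regularMatrices 𝔱 m) : (fun x => L (F x)) ∈ regularMatrices 𝔱 m := by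
  have e : (fun x => L (F x)) = ∑ i, ∑ j, fun x => F x i j • L (Matrix.single i j 1) := by
    ext1 x
    conv_lhs => rw [Matrix.matrix_eq_sum_single (F x)]
    simp only [map_sum, Finset.sum_apply]
    refine Finset.sum_congr rfl fun i _ => Finset.sum_congr rfl fun j _ => ?_
    rw [← map_smul, Matrix.smul_single, smul_eq_mul, mul_one]
  rw [e]
  exact sum_mem fun i _ => sum_mem fun j _ =>
    smul_mem_regularMatrices (hF i j) (const_mem_regularMatrices _)

/-- The nilpotency bound is uniform in `x`, so the exponential is one fixed polynomial in `F`. -/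
theorem exp_mem_regularMatrices (hF : F ∈ regularMatrices 𝔱 m) {K : ℕ} (hK : ∀ x, F x ^ K = 0) :
    (fun x => NormedSpace.exp (F x)) ∈ regularMatrices 𝔱 m := by
  have e : (fun x => NormedSpace.exp (F x)) =
      ∑ n ∈ Finset.range K, ((n.factorial : ℂ)⁻¹) • F ^ n := by
    ext1 x
    rw [exp_eq_sum_of_pow_eq_zero (hK x)]
    simp
  rw [e]
  exact sum_mem fun n _ => Subalgebra.smul_mem _ (pow_mem hF n) _

/-- A linear left inverse of `ρ` turns `L` into a linear map on matrices. -/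
theorem map_linear_mem_regularMatrices {ρ : 𝔤 →ₗ⁅ℂ⁆ Matrix (Fin m) (Fin m) ℂ}
    (hρ : Function.Injective ρ) (L : 𝔤 →ₗ[ℂ] 𝔤) {r : RegularElement 𝔱 → 𝔤}
    (hr : (fun x => ρ (r x)) ∈ regularMatrices 𝔱 m) :
    (fun x => ρ (L (r x))) ∈ regularMatrices 𝔱 m := by
  obtain ⟨s, hs⟩ := (ρ : 𝔤 →ₗ[ℂ] Matrix (Fin m) (Fin m) ℂ).exists_leftInverse_of_injective
    (LinearMap.ker_eq_bot.2 hρ)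
  convert linear_mem_regularMatrices ((ρ : 𝔤 →ₗ[ℂ] Matrix (Fin m) (Fin m) ℂ) ∘ₗ L ∘ₗ s) hr
    using 2 with x
  have : s (ρ (r x)) = r x := LinearMap.congr_fun hs (r x)
  simp [this]

theorem map_coe_mem_regularMatrices (ρ : 𝔤 →ₗ⁅ℂ⁆ Matrix (Fin m) (Fin m) ℂ) :
    (fun x : RegularElement 𝔱 => ρ (x.1 : 𝔤)) ∈ regularMatrices 𝔱 m := fun i j =>
  Algebra.subset_adjoin (Or.inl ⟨Matrix.entryLinearMap ℂ ℂ i j ∘ₗ cartanRep 𝔱 ρ, rfl⟩)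

theorem root_inv_mem_regularFunctions (α : 𝔱.root) :
    (fun x : RegularElement 𝔱 => ((rootSystem 𝔱).root α x.1)⁻¹) ∈ regularFunctions 𝔱 :=
  Algebra.subset_adjoin (Or.inr ⟨α, rfl⟩)

end RegularMatrices

/-! ### Existence of `n_x` by successive approximation -/

section Existence

variable {𝔤 : Type*} [LieRing 𝔤] [LieAlgebra ℂ 𝔤] [FiniteDimensional ℂ 𝔤] [LieAlgebra.IsSimple ℂ 𝔤]
  {𝔱 : LieSubalgebra ℂ 𝔤} [𝔱.IsCartanSubalgebra] {m : ℕ}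
  (b : (rootSystem 𝔱).Base) (ρ : 𝔤 →ₗ⁅ℂ⁆ Matrix (Fin m) (Fin m) ℂ)

theorem map_coe_mem_heightFil (C : AddSubmonoid (Dual ℂ 𝔱)) (x : 𝔱) :
    ρ (x : 𝔤) ∈ heightFil b ρ C 0 := by
  refine adWeightSpace_le_adWeightSum (S := weightTail C (heightElement b) 0) (β := 0)
    ⟨zero_mem _, 0, le_rfl, by simp⟩ (mem_adWeightSpace.2 fun t => ?_)
  have h : ⁅t, x⁆ = 0 := trivial_lie_zero _ _ _ _
  have h' : ⁅(t : 𝔤), (x : 𝔤)⁆ = 0 := congrArg Subtype.val h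
  rw [cartanRep_apply, ← map_lie_eq_sub, h', map_zero, LinearMap.zero_apply, zero_smul]

theorem lie_weightProj (γ : LieModule.Weight ℂ 𝔱 𝔤) (y : 𝔤) (x : 𝔱) :
    ⁅weightProj γ y, (x : 𝔤)⁆ = -(weightForm γ x • weightProj γ y) := by
  have h : ⁅(x : 𝔤), weightProj γ y⁆ = γ x • weightProj γ y :=
    lie_eq_smul_of_mem_rootSpace (weightProj_mem γ y) x
  rw [← lie_skew, h]
  rfl

theorem lie_sum_weightProj {k : ℤ} (hk : 1 ≤ k) (y : 𝔤) (x : RegularElement 𝔱) :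
    ⁅∑ γ ∈ degreeWeights b k, (weightForm γ x.1)⁻¹ • weightProj γ y, (x.1 : 𝔤)⁆ =
      -degreePart b k y := by
  rw [degreePart, sum_lie, ← Finset.sum_neg_distrib]
  refine Finset.sum_congr rfl fun γ hγ => ?_
  obtain ⟨α, -, -, hα⟩ := exists_isPos_of_mem_degreeWeights b hk hγ
  have h0 : weightForm γ x.1 ≠ 0 := by rw [← hα]; exact x.2 α
  rw [smul_lie, lie_weightProj, smul_neg, smul_smul, inv_mul_cancel₀ h0, one_smul]

/-- One step of the construction of an element of the unipotent group conjugating `x` to `x + e`: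
the error term is pushed into the next step of the filtration. -/
theorem exists_regular_conj_step (hρ : Function.Injective ρ) {e : 𝔤} (he : e ∈ nilpotentPart b)
    {k : ℤ} (hk : 1 ≤ k) {n : RegularElement 𝔱 → unipotentGroup b ρ} {r : RegularElement 𝔱 → 𝔤}
    (hn : (fun x => ((n x : GL (Fin m) ℂ) : Matrix (Fin m) (Fin m) ℂ)) ∈ regularMatrices 𝔱 m)
    (hr : (fun x => ρ (r x)) ∈ regularMatrices 𝔱 m)
    (h : ∀ x, AdEq ρ (n x) (x.1 : 𝔤) (x.1 + e + r x)) (hrk : ∀ x, ρ (r x) ∈ heightFil b ρ ⊤ k) :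
    ∃ (n' : RegularElement 𝔱 → unipotentGroup b ρ) (r' : RegularElement 𝔱 → 𝔤),
      (fun x => ((n' x : GL (Fin m) ℂ) : Matrix (Fin m) (Fin m) ℂ)) ∈ regularMatrices 𝔱 m ∧
      (fun x => ρ (r' x)) ∈ regularMatrices 𝔱 m ∧
      (∀ x, AdEq ρ (n' x) (x.1 : 𝔤) (x.1 + e + r' x)) ∧
      ∀ x, ρ (r' x) ∈ heightFil b ρ ⊤ (k + 1) := by
  -- This is the solution of `⁅y x, x⁆ = -degreePart b k (r x)`; since `k ≥ 1`, the weights being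
  -- inverted are positive roots.
  set y : RegularElement 𝔱 → 𝔤 := fun x =>
    ∑ γ ∈ degreeWeights b k, (weightForm γ x.1)⁻¹ • weightProj γ (r x) with hy
  have hyn : ∀ x, y x ∈ nilpotentPart b := fun x => sum_smul_weightProj_mem b hk _ _
  have hyreg : (fun x => ρ (y x)) ∈ regularMatrices 𝔱 m := by
    have e1 : (fun x => ρ (y x)) = ∑ γ ∈ degreeWeights b k,
        fun x : RegularElement 𝔱 => (weightForm γ x.1)⁻¹ • ρ (weightProj γ (r x)) := by
      ext1 x
      simp [hy, map_sum]
    rw [e1]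
    refine sum_mem fun γ hγ => smul_mem_regularMatrices ?_ (map_linear_mem_regularMatrices hρ _ hr)
    obtain ⟨α, -, -, hα⟩ := exists_isPos_of_mem_degreeWeights b hk hγ
    rw [← hα]
    exact root_inv_mem_regularFunctions α
  obtain ⟨K, hK⟩ := exists_forall_pow_eq_zero (cartanRep 𝔱 ρ) (heightElement b)
  have hyK : ∀ x, ρ (y x) ^ K = 0 := fun x => hK _ _ (map_mem_heightFil b ρ (hyn x))
  have hyk : ∀ x, ρ (y x) ∈ heightFil b ρ ⊤ k := fun x => adWeightSum_weightPiece_le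
    (map_sum_weightProj_mem ρ (S := weightPiece ⊤ (heightElement b) k)
      (fun γ hγ => ⟨trivial, (mem_degreeWeights b).1 hγ⟩) _ _)
  set u : RegularElement 𝔱 → unipotentGroup b ρ := fun x =>
    groupExp (nilpotentRep b ρ) ⟨y x, hyn x⟩
    with hu
  have hu1 : ∀ x, ((u x : GL (Fin m) ℂ) : Matrix (Fin m) (Fin m) ℂ) = NormedSpace.exp (ρ (y x)) :=
    fun x => rfl
  have hu2 : ∀ x, (((u x : GL (Fin m) ℂ)⁻¹ : GL (Fin m) ℂ) : Matrix (Fin m) (Fin m) ℂ) =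
      NormedSpace.exp (-ρ (y x)) := fun x => by
    change ((expGL (ρ (y x)))⁻¹ : GL (Fin m) ℂ).val = _
    rw [expGL_inv, coe_expGL]
  choose z hz using fun x => exists_conj_eq_of_mem_unipotentGroup b ρ (u x).2 (x.1 + e + r x)
  refine ⟨fun x => u x * n x, fun x => z x - (x.1 + e), ?_, ?_, fun x => ?_, fun x => ?_⟩
  · exact mul_mem (exp_mem_regularMatrices hyreg hyK) hn
  · have e1 : (fun x => ρ (z x - (x.1 + e))) = fun x =>
        NormedSpace.exp (ρ (y x)) * (ρ (x.1 : 𝔤) + ρ e + ρ (r x)) * NormedSpace.exp (-ρ (y x)) -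
          (ρ (x.1 : 𝔤) + ρ e) := by
      ext1 x
      rw [map_sub, ← hz, hu1, hu2, map_add, map_add]
    rw [e1]
    have h1 : (fun x : RegularElement 𝔱 => ρ (x.1 : 𝔤) + ρ e) ∈ regularMatrices 𝔱 m :=
      add_mem (map_coe_mem_regularMatrices ρ) (const_mem_regularMatrices _)
    refine sub_mem (mul_mem (mul_mem (exp_mem_regularMatrices hyreg hyK) (add_mem h1 hr))
      (exp_mem_regularMatrices (F := fun x => -ρ (y x)) (neg_mem hyreg) (K := K) fun x => ?_)) h1
    rw [neg_pow, hyK, mul_zero]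
  · have e1 : (x.1 : 𝔤) + e + (z x - (x.1 + e)) = z x := by abel
    rw [e1, AdEq, ← hz, ← h x, Subgroup.coe_mul, mul_inv_rev, Units.val_mul, Units.val_mul]
    noncomm_ring
  · have hx0 := map_coe_mem_heightFil b ρ ⊤ x.1
    have he1 : ρ e ∈ heightFil b ρ ⊤ 1 := adFil_mono le_top le_rfl (map_mem_heightFil b ρ he)
    have her : ρ e + ρ (r x) ∈ heightFil b ρ ⊤ 1 := add_mem he1 (adFil_anti hk (hrk x))
    have hZ : ρ (x.1 + e + r x) ∈ heightFil b ρ ⊤ 0 := by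
      rw [map_add, map_add, add_assoc]
      exact add_mem hx0 (adFil_anti (by lia) her)
    have h1 := exp_conj_sub_mem_adFil hk (hyk x) hZ
    have h2 := sub_map_degreePart_mem_heightFil b ρ (hrk x)
    have h3 : ρ (y x) * (ρ e + ρ (r x)) - (ρ e + ρ (r x)) * ρ (y x) ∈ heightFil b ρ ⊤ (k + 1) :=
      sub_mem (mul_mem_adFil (hyk x) her) (adFil_anti (by lia) (mul_mem_adFil her (hyk x)))
    have h4 : ρ (y x) * ρ (x.1 : 𝔤) - ρ (x.1 : 𝔤) * ρ (y x) = -ρ (degreePart b k (r x)) := by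
      rw [← map_lie_eq_sub, lie_sum_weightProj b hk, map_neg]
    rw [← hu1, ← hu2, hz] at h1
    -- The new error is the sum of the higher-order terms of the conjugation, the part of `r` of
    -- degree above `k`, and `[y, e + r]`; the degree `k` part of `r` has been cancelled by `[y,
    -- x]`.
    convert add_mem (add_mem h1 h2) h3 using 1
    rw [sub_eq_add_neg (ρ (r x)), ← h4]
    simp only [map_add, map_sub]
    noncomm_ring

/-- Starting from `n = 1` with error `-e`, each step raises the degree of the error by one and
preserves regularity; once the filtration has vanished, injectivity of `ρ` makes the error zero. -/
theorem exists_regular_conj (hρ : Function.Injective ρ) {e : 𝔤} (he : e ∈ nilpotentPart b) :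
    ∃ n : RegularElement 𝔱 → unipotentGroup b ρ,
      (fun x => ((n x : GL (Fin m) ℂ) : Matrix (Fin m) (Fin m) ℂ)) ∈ regularMatrices 𝔱 m ∧
      ∀ x, AdEq ρ (n x) (x.1 : 𝔤) (x.1 + e) := by
  have key : ∀ k : ℕ, ∃ (n : RegularElement 𝔱 → unipotentGroup b ρ) (r : RegularElement 𝔱 → 𝔤),
      (fun x => ((n x : GL (Fin m) ℂ) : Matrix (Fin m) (Fin m) ℂ)) ∈ regularMatrices 𝔱 m ∧
      (fun x => ρ (r x)) ∈ regularMatrices 𝔱 m ∧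
      (∀ x, AdEq ρ (n x) (x.1 : 𝔤) (x.1 + e + r x)) ∧
      ∀ x, ρ (r x) ∈ heightFil b ρ ⊤ (k + 1) := by
    intro k
    induction k with
    | zero =>
      refine ⟨fun _ => 1, fun _ => -e, const_mem_regularMatrices _, const_mem_regularMatrices _,
        fun x => by simp [AdEq], fun x => ?_⟩
      rw [map_neg]
      exact neg_mem (by simpa using (adFil_mono le_top le_rfl (map_mem_heightFil b ρ he) :
        ρ e ∈ heightFil b ρ ⊤ 1))
    | succ k ih =>
      obtain ⟨n, r, hn, hr, h, hrk⟩ := ih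
      exact_mod_cast exists_regular_conj_step b ρ hρ he (by lia) hn hr h hrk
  obtain ⟨K, -, hK⟩ := exists_adFil_eq_bot (cartanRep 𝔱 ρ) (heightElement b)
  obtain ⟨n, r, hn, -, h, hrk⟩ := key K
  refine ⟨n, hn, fun x => ?_⟩
  have h0 := adFil_anti (by lia) (hrk x) (j := K)
  rw [hK, Submodule.mem_bot] at h0
  have hr0 : r x = 0 := hρ (by rw [h0, map_zero])
  simpa [hr0] using h x

end Existence

/-! ### Expansion of `n_x` over words in the simple root vectors -/

section Words

variable {𝔤 : Type*} [LieRing 𝔤] [LieAlgebra ℂ 𝔤] [FiniteDimensional ℂ 𝔤] [LieAlgebra.IsSimple ℂ 𝔤]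
  {𝔱 : LieSubalgebra ℂ 𝔤} [𝔱.IsCartanSubalgebra] {m : ℕ}
  (b : (rootSystem 𝔱).Base)

/-- The sum of the simple roots in a word. -/
def wordWeight (l : List b.support) : Dual ℂ 𝔱 :=
  (l.map fun j : b.support => (rootSystem 𝔱).root j).sum

theorem wordWeight_cons (j : b.support) (l : List b.support) :
    wordWeight b (j :: l) = (rootSystem 𝔱).root j + wordWeight b l := by
  simp [wordWeight]

theorem wordWeight_apply (l : List b.support) (x : 𝔱) :
    wordWeight b l x = (l.map fun j : b.support => (rootSystem 𝔱).root j x).sum := by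
  induction l with
  | nil => simp [wordWeight]
  | cons j l ih => rw [wordWeight_cons, LinearMap.add_apply, ih, List.map_cons, List.sum_cons]

theorem wordWeight_mem_rootCone (l : List b.support) : wordWeight b l ∈ rootCone b := by
  induction l with
  | nil => exact zero_mem _
  | cons j l ih =>
    rw [wordWeight_cons]
    exact add_mem (AddSubmonoid.subset_closure ⟨j, b.isPos_of_mem_support j.2, rfl⟩) ih

theorem wordWeight_heightElement (l : List b.support) :
    wordWeight b l (heightElement b) = l.length := by
  rw [wordWeight_apply]
  induction l with
  | nil => simp
  | cons j l ih =>
    rw [List.map_cons, List.sum_cons, ih, root_heightElement, b.height_one_of_mem_support j.2]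
    push_cast [List.length_cons]
    ring

theorem wordWeight_ne_zero {l : List b.support} (hl : l ≠ []) : wordWeight b l ≠ 0 := by
  intro h
  have h1 := wordWeight_heightElement b l
  rw [h, LinearMap.zero_apply] at h1
  have : l.length = 0 := by exact_mod_cast h1.symm
  exact hl (List.length_eq_zero_iff.1 this)

theorem partialWeight_cons_succ (j : b.support) (l : List b.support) (k : ℕ) :
    partialWeight b (j :: l) (k + 1) = (rootSystem 𝔱).root j + partialWeight b l k := by
  simp [partialWeight]

theorem partialWeight_length (l : List b.support) :
    partialWeight b l l.length = wordWeight b l := by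
  induction l with
  | nil => simp [partialWeight, wordWeight]
  | cons j l ih => rw [List.length_cons, partialWeight_cons_succ, ih, wordWeight_cons]

theorem seqCoeff_nil (x : 𝔱) : seqCoeff b [] x = 1 := by simp [seqCoeff]

/-- For `k ≥ 1` the difference `β_k - β_p` does not involve the first letter, and `k = 0`
contributes `-1 / β_p`. This recursion drives both the shuffle identity and the equation `[x, g] =
-e g`. -/
theorem seqCoeff_cons {x : 𝔱} {j : b.support} {l : List b.support}
    (h : wordWeight b (j :: l) x ≠ 0) :
    wordWeight b (j :: l) x * seqCoeff b (j :: l) x = -seqCoeff b l x := by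
  have e0 : partialWeight b (j :: l) 0 = 0 := by simp [partialWeight]
  rw [seqCoeff, partialWeight_length, List.length_cons, Finset.prod_range_succ', e0, seqCoeff,
    partialWeight_length, LinearMap.zero_apply, zero_sub]
  have e1 : ∏ k ∈ Finset.range l.length,
      1 / (partialWeight b (j :: l) (k + 1) x - wordWeight b (j :: l) x) =
      ∏ k ∈ Finset.range l.length, 1 / (partialWeight b l k x - wordWeight b l x) := by
    refine Finset.prod_congr rfl fun k _ => ?_
    rw [partialWeight_cons_succ, wordWeight_cons, LinearMap.add_apply, LinearMap.add_apply,
      add_sub_add_left_eq_sub]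
  rw [e1]
  field_simp

variable (ρ : 𝔤 →ₗ⁅ℂ⁆ Matrix (Fin m) (Fin m) ℂ) (e : b.support → nilpotentPart b)

/-- The product of the matrices of the root vectors in a word. -/
def wordMatrix (l : List b.support) : Matrix (Fin m) (Fin m) ℂ :=
  (l.map fun j => ρ (e j : 𝔤)).prod

theorem wordMatrix_cons (j : b.support) (l : List b.support) :
    wordMatrix b ρ e (j :: l) = ρ (e j : 𝔤) * wordMatrix b ρ e l := by
  simp [wordMatrix]

variable {e}

theorem wordMatrix_mem_adWeightSpace
    (he : ∀ i : b.support, (e i : 𝔤) ∈ rootSpace 𝔱 (i.1 : LieModule.Weight ℂ 𝔱 𝔤))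
    (l : List b.support) :
    wordMatrix b ρ e l ∈ adWeightSpace (cartanRep 𝔱 ρ) (wordWeight b l) := by
  induction l with
  | nil => simpa [wordMatrix, wordWeight] using one_mem_adWeightSpace
  | cons j l ih =>
    rw [wordMatrix_cons, wordWeight_cons]
    exact mul_mem_adWeightSpace (map_mem_adWeightSpace ρ (he j)) ih

theorem wordMatrix_mem_heightFil
    (he : ∀ i : b.support, (e i : 𝔤) ∈ rootSpace 𝔱 (i.1 : LieModule.Weight ℂ 𝔱 𝔤))
    (l : List b.support) :
    wordMatrix b ρ e l ∈ heightFil b ρ (rootCone b) l.length :=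
  adWeightSpace_le_adWeightSum (S := weightTail (rootCone b) (heightElement b) l.length)
    ⟨wordWeight_mem_rootCone b l, l.length, le_rfl, by simp [wordWeight_heightElement]⟩
    (wordMatrix_mem_adWeightSpace b ρ he l)

theorem finite_support_wordMatrix
    (he : ∀ i : b.support, (e i : 𝔤) ∈ rootSpace 𝔱 (i.1 : LieModule.Weight ℂ 𝔱 𝔤)) :
    (Function.support (wordMatrix b ρ e)).Finite := by
  obtain ⟨K, -, hK⟩ := exists_adFil_eq_bot (cartanRep 𝔱 ρ) (heightElement b)
  refine (List.finite_length_lt b.support K).subset fun l hl => ?_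
  by_contra hlt
  apply hl
  have := adFil_anti (by simpa using hlt) (wordMatrix_mem_heightFil b ρ he l) (j := K)
  rwa [hK, Submodule.mem_bot] at this

/-- The equation `[x, g] + e g = 0` has at most one solution among the matrices of the form
`1 + (positive degree)`, for generic `x`. -/
theorem eq_zero_of_adEnd_eq_neg_mul {x : 𝔱} (hx : ∀ β ∈ rootCone b, β ≠ 0 → β x ≠ 0)
    {E d : Matrix (Fin m) (Fin m) ℂ} (hE : E ∈ heightFil b ρ (rootCone b) 1)
    (hd : d ∈ heightFil b ρ (rootCone b) 1) (h : adEnd (cartanRep 𝔱 ρ) x d = -(E * d)) :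
    d = 0 := by
  have hmem : ∀ k : ℕ, d ∈ heightFil b ρ (rootCone b) (k + 1) := by
    intro k
    induction k with
    | zero => simpa using hd
    | succ k ih =>
      have ih' := ih
      rw [heightFil, adFil_eq_sup] at ih'
      obtain ⟨X, hX, Z, hZ, hXZ⟩ := Submodule.mem_sup.1 ih'
      have hX0 : adEnd (cartanRep 𝔱 ρ) x X = 0 := by
        refine Submodule.disjoint_def.1 (disjoint_weightPiece_adFil (C' := rootCone b)) _
          (adEnd_mem_adWeightSum x hX) ?_
        have : adEnd (cartanRep 𝔱 ρ) x X = -(E * d) - adEnd (cartanRep 𝔱 ρ) x Z := by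
          rw [← h, ← hXZ, map_add]; abel
        rw [this]
        exact sub_mem (neg_mem (adFil_anti (by lia) (mul_mem_adFil hE ih)))
          (adEnd_mem_adWeightSum x hZ)
      -- The weights of `X` are elements of `Q₊` that need not be roots, so regularity of `x` would
      -- not suffice: this is where genericity on all of `Q₊` is needed.
      have hzero : X = 0 := by
        refine eq_zero_of_adEnd_eq_zero x ?_ hX hX0
        rintro β ⟨hβ, hβ'⟩
        refine hx β hβ ?_
        rintro rfl
        rw [LinearMap.zero_apply] at hβ'
        have : (0 : ℤ) = k + 1 := by exact_mod_cast hβ'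
        lia
      rw [← hXZ, hzero, zero_add]
      exact_mod_cast hZ
  obtain ⟨K, -, hK⟩ := exists_adFil_eq_bot (cartanRep 𝔱 ρ) (heightElement b)
  have := adFil_anti (by lia) (hmem K) (j := K)
  rwa [hK, Submodule.mem_bot] at this

/-- Both sides solve `[x, g] = -e g` and lie in `1 + (positive degree)`, so
`eq_zero_of_adEnd_eq_neg_mul` applies to their difference. -/
theorem coe_eq_finsum_wordMatrix
    (he : ∀ i : b.support, (e i : 𝔤) ∈ rootSpace 𝔱 (i.1 : LieModule.Weight ℂ 𝔱 𝔤))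
    {x : 𝔱} (hx : ∀ β ∈ rootCone b, β ≠ 0 → β x ≠ 0)
    {g : GL (Fin m) ℂ} (hg : g ∈ unipotentGroup b ρ)
    (h : AdEq ρ g (x : 𝔤) ((x : 𝔤) + ∑ i : b.support, (e i : 𝔤))) :
    (g : Matrix (Fin m) (Fin m) ℂ) = ∑ᶠ l, seqCoeff b l x • wordMatrix b ρ e l := by
  set F : List b.support → Matrix (Fin m) (Fin m) ℂ := fun l => seqCoeff b l x • wordMatrix b ρ e l
    with hF
  have hfin : F.support.Finite := (finite_support_wordMatrix b ρ he).subset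
    fun l hl h0 => hl (by simp [hF, h0])
  have hsplit := finsum_list_eq hfin
  have hF0 : F [] = 1 := by simp [hF, seqCoeff_nil, wordMatrix]
  set E := ρ (∑ i : b.support, (e i : 𝔤)) with hE
  have hEmem : E ∈ heightFil b ρ (rootCone b) 1 :=
    map_mem_heightFil b ρ (sum_mem fun i _ => (e i).2)
  have h1 : (∑ᶠ l, F l) - 1 ∈ heightFil b ρ (rootCone b) 1 := by
    rw [hsplit, hF0, add_sub_cancel_left]
    refine sum_mem fun j _ => ?_
    refine finsum_induction (fun X => X ∈ heightFil b ρ (rootCone b) 1) (zero_mem _)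
      (fun _ _ => add_mem) fun l => Submodule.smul_mem _ _ ?_
    exact adFil_anti (by simp) (wordMatrix_mem_heightFil b ρ he (j :: l))
  have h2 : adEnd (cartanRep 𝔱 ρ) x (∑ᶠ l, F l) = -(E * ∑ᶠ l, F l) := by
    have hfin2 : (Function.support fun l => adEnd (cartanRep 𝔱 ρ) x (F l)).Finite :=
      hfin.subset (Function.support_comp_subset (map_zero _) F)
    have e1 : adEnd (cartanRep 𝔱 ρ) x (∑ᶠ l, F l) = ∑ᶠ l, adEnd (cartanRep 𝔱 ρ) x (F l) :=
      (adEnd (cartanRep 𝔱 ρ) x).toAddMonoidHom.map_finsum hfin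
    have e2 : ∀ j : b.support, ρ (e j : 𝔤) * ∑ᶠ l, F l = ∑ᶠ l, ρ (e j : 𝔤) * F l := fun j =>
      (AddMonoidHom.mulLeft (ρ (e j : 𝔤))).map_finsum hfin
    -- The empty word commutes with `x`; the word `j :: l` is a weight vector, and `seqCoeff_cons`
    -- turns its bracket with `x` into `-ρ (e j) * F l`.
    rw [e1, finsum_list_eq hfin2, hF0, hE, map_sum, Finset.sum_mul, ← Finset.sum_neg_distrib]
    have e3 : adEnd (cartanRep 𝔱 ρ) x 1 = 0 := by simp [adEnd_apply]
    rw [e3, zero_add]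
    refine Finset.sum_congr rfl fun j _ => ?_
    rw [e2, ← finsum_neg_distrib]
    refine finsum_congr fun l => ?_
    have e4 := mem_adWeightSpace.1 (wordMatrix_mem_adWeightSpace b ρ he (j :: l)) x
    rw [hF, map_smul, adEnd_apply, e4, smul_smul, mul_comm, seqCoeff_cons b (hx _
      (wordWeight_mem_rootCone b _) (wordWeight_ne_zero b (by simp))), wordMatrix_cons,
      mul_smul_comm, neg_smul]
  have h3 : adEnd (cartanRep 𝔱 ρ) x (g : Matrix (Fin m) (Fin m) ℂ) = -(E * g) := by
    have h4 : (g : Matrix (Fin m) (Fin m) ℂ) * ρ (x : 𝔤) = (ρ (x : 𝔤) + E) * g := by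
      rw [hE, ← map_add, ← h, mul_assoc, Units.inv_mul, mul_one]
    rw [adEnd_apply, cartanRep_apply, h4]
    noncomm_ring
  rw [← sub_eq_zero]
  refine eq_zero_of_adEnd_eq_neg_mul b ρ hx hEmem ?_ ?_
  · have := sub_mem (sub_one_mem_of_mem_unipotentGroup b ρ hg) h1
    simpa using this
  · rw [map_sub, h2, h3]
    noncomm_ring

end Words

/-! ### Pairing words with regular functions -/

section Pairing

variable {m : ℕ} {L : Type*} [LieRing L] [LieAlgebra ℂ L] (ρ : L →ₗ⁅ℂ⁆ Matrix (Fin m) (Fin m) ℂ)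

/-- The evaluation of regular functions at an element of the group. -/
def evalAt (g : expGroup ρ) : coordRing (expGroup ρ) →ₐ[ℂ] ℂ :=
  (Pi.evalAlgHom ℂ (fun _ : expGroup ρ => ℂ) g).comp (coordRing (expGroup ρ)).val

@[simp]
theorem evalAt_apply (g : expGroup ρ) (f : coordRing (expGroup ρ)) :
    evalAt ρ g f = (f : expGroup ρ → ℂ) g := rfl

theorem lieAction_mul (a : L) (f g : coordRing (expGroup ρ)) :
    lieAction ρ a (f * g) = f * lieAction ρ a g + g * lieAction ρ a f :=
  (infActEnd ρ a).leibniz f g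

variable {ι : Type*} (e : ι → L)

theorem prod_lieAction_algebraMap (r : ℂ) {l : List ι} (hl : l ≠ []) :
    (l.map fun j => lieAction ρ (e j)).prod (algebraMap ℂ (coordRing (expGroup ρ)) r) = 0 := by
  induction l with
  | nil => exact absurd rfl hl
  | cons j l ih =>
    rw [List.map_cons, List.prod_cons, Module.End.mul_apply]
    by_cases h : l = []
    · subst h
      exact (infActEnd ρ (e j)).map_algebraMap r
    · rw [ih h, map_zero]

theorem prod_lieAction_entry (p q : Fin m) (l : List ι) :
    (l.map fun j => lieAction ρ (e j)).prod (entry ρ p q) =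
      ∑ k, (l.map fun j => ρ (e j)).prod k q • entry ρ p k := by
  induction l with
  | nil => simp [Matrix.one_apply]
  | cons j l ih =>
    rw [List.map_cons, List.prod_cons, Module.End.mul_apply, ih, map_sum, List.map_cons,
      List.prod_cons]
    simp only [map_smul, Matrix.mul_apply, Finset.sum_smul]
    have h : ∀ k, lieAction ρ (e j) (entry ρ p k) = ∑ s, ρ (e j) s k • entry ρ p s :=
      infActEnd_entry ρ (e j) p
    simp only [h, Finset.smul_sum, smul_smul]
    rw [Finset.sum_comm]
    simp only [mul_comm]

/-- The pairing of a product of elements of the Lie algebra with a regular function. -/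
def wordPairing (f : coordRing (expGroup ρ)) (l : List ι) : ℂ :=
  evalAt ρ 1 ((l.map fun j => lieAction ρ (e j)).prod f)

theorem wordPairing_algebraMap_nil (r : ℂ) :
    wordPairing ρ e (algebraMap ℂ (coordRing (expGroup ρ)) r) [] = r := by
  simp [wordPairing]

theorem wordPairing_algebraMap (r : ℂ) {l : List ι} (hl : l ≠ []) :
    wordPairing ρ e (algebraMap ℂ (coordRing (expGroup ρ)) r) l = 0 := by
  rw [wordPairing, prod_lieAction_algebraMap ρ e r hl, map_zero]

theorem wordPairing_entry (p q : Fin m) (l : List ι) :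
    wordPairing ρ e (entry ρ p q) l = (l.map fun j => ρ (e j)).prod p q := by
  rw [wordPairing, prod_lieAction_entry, map_sum, Finset.sum_eq_single p]
  · simp [entry]
  · intro k _ hk
    simp [entry, Matrix.one_apply_ne hk.symm]
  · simp

theorem wordPairing_add (f g : coordRing (expGroup ρ)) :
    wordPairing ρ e (f + g) = wordPairing ρ e f + wordPairing ρ e g := by
  ext l
  simp [wordPairing]

/-- Iterating the Leibniz rule distributes the letters of `l` between `f` and `g`, and evaluation at
`1` is multiplicative. So pairing with words carries products of functions to shuffle products. -/
theorem wordPairing_mul (f g : coordRing (expGroup ρ)) (l : List ι) :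
    wordPairing ρ e (f * g) l =
      ((unshuffles l).map fun p => wordPairing ρ e f p.1 * wordPairing ρ e g p.2).sum := by
  rw [wordPairing, prod_map_mul_eq_sum_unshuffles _ fun i => lieAction_mul ρ (e i), map_list_sum,
    List.map_map]
  simp only [Function.comp_def, map_mul, wordPairing]

variable {ρ e}

theorem coordRing_induction {P : coordRing (expGroup ρ) → Prop}
    (entry : ∀ i j, P (entry ρ i j)) (algebraMap : ∀ r, P (algebraMap ℂ _ r))
    (add : ∀ f g, P f → P g → P (f + g)) (mul : ∀ f g, P f → P g → P (f * g))
    (f : coordRing (expGroup ρ)) : P f := by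
  have hf : f ∈ Algebra.adjoin ℂ (Set.range fun p : Fin m × Fin m => _root_.entry ρ p.1 p.2) := by
    rw [adjoin_entry]; trivial
  induction hf using Algebra.adjoin_induction with
  | mem f h => obtain ⟨p, rfl⟩ := h; exact entry _ _
  | algebraMap r => exact algebraMap r
  | add f g _ _ hf hg => exact add f g hf hg
  | mul f g _ _ hf hg => exact mul f g hf hg

theorem finite_support_wordPairing
    (h : (Function.support fun l : List ι => (l.map fun j => ρ (e j)).prod).Finite)
    (f : coordRing (expGroup ρ)) : (Function.support (wordPairing ρ e f)).Finite := by
  refine coordRing_induction (P := fun f => (Function.support (wordPairing ρ e f)).Finite)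
    (fun p q => ?_) (fun r => ?_) (fun f g hf hg => ?_)
    (fun f g hf hg => ?_) f
  · refine h.subset fun l hl h0 => hl ?_
    simp only [wordPairing_entry, h0, Matrix.zero_apply]
  · refine (Set.finite_singleton []).subset fun l hl => ?_
    by_contra h0
    exact hl (wordPairing_algebraMap ρ e r h0)
  · rw [wordPairing_add]
    exact (hf.union hg).subset (Function.support_add _ _)
  · have hfun : wordPairing ρ e (f * g) = fun l => ((unshuffles l).map
        fun p => wordPairing ρ e f p.1 * wordPairing ρ e g p.2).sum :=
      funext (wordPairing_mul ρ e f g)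
    rw [hfun]
    refine finite_support_unshuffles (A := fun p => wordPairing ρ e f p.1 * wordPairing ρ e g p.2)
      ((hf.prod hg).subset fun p hp => ?_)
    exact ⟨left_ne_zero_of_mul hp, right_ne_zero_of_mul hp⟩

/-- Both sides are algebra morphisms in `f`, the right one by `finsum_unshuffles`. It therefore
suffices to compare them on matrix entries, where the identity is `hg`. -/
theorem eval_eq_finsum_wordPairing {β : ι → ℂ} {c : List ι → ℂ}
    (hβ : ∀ l ≠ [], (l.map β).sum ≠ 0) (c_nil : c [] = 1)
    (c_cons : ∀ a l, ((a :: l).map β).sum * c (a :: l) = - c l)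
    (h : (Function.support fun l : List ι => (l.map fun j => ρ (e j)).prod).Finite)
    {g : expGroup ρ} (hg : ((g : GL (Fin m) ℂ) : Matrix (Fin m) (Fin m) ℂ) =
      ∑ᶠ l : List ι, c l • (l.map fun j => ρ (e j)).prod)
    (f : coordRing (expGroup ρ)) :
    (f : expGroup ρ → ℂ) g = ∑ᶠ l, wordPairing ρ e f l * c l := by
  have hfin := finite_support_wordPairing (ρ := ρ) (e := e) h
  have hmulfin : ∀ f, (Function.support fun l => wordPairing ρ e f l * c l).Finite := fun f =>
    (hfin f).subset fun l hl => left_ne_zero_of_mul hl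
  refine coordRing_induction (P := fun f : coordRing (expGroup ρ) =>
    (f : expGroup ρ → ℂ) g = ∑ᶠ l, wordPairing ρ e f l * c l) (fun p q => ?_) (fun r => ?_)
    (fun f f' hf hf' => ?_) (fun f f' hf hf' => ?_) f
  · have h1 : (entry ρ p q : expGroup ρ → ℂ) g =
        (Matrix.entryLinearMap ℂ ℂ p q).toAddMonoidHom
          ((g : GL (Fin m) ℂ) : Matrix (Fin m) (Fin m) ℂ) := rfl
    rw [h1, hg, AddMonoidHom.map_finsum _
      (h.subset fun l hl h0 => hl (by simp only [h0, smul_zero]))]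
    refine finsum_congr fun l => ?_
    rw [wordPairing_entry, mul_comm]
    rfl
  · rw [finsum_eq_single _ [], wordPairing_algebraMap_nil, c_nil, mul_one]
    · rfl
    · intro l hl
      rw [wordPairing_algebraMap ρ e r hl, zero_mul]
  · have h1 : ((f + f' : coordRing (expGroup ρ)) : expGroup ρ → ℂ) g =
      (f : expGroup ρ → ℂ) g + (f' : expGroup ρ → ℂ) g := rfl
    rw [h1, hf, hf', ← finsum_add_distrib (hmulfin f) (hmulfin f'), wordPairing_add]
    simp only [Pi.add_apply, add_mul]
  · have h1 : ((f * f' : coordRing (expGroup ρ)) : expGroup ρ → ℂ) g =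
      (f : expGroup ρ → ℂ) g * (f' : expGroup ρ → ℂ) g := rfl
    rw [h1, hf, hf', ← finsum_unshuffles β hβ c_nil c_cons (hfin f) (hfin f')]
    simp only [wordPairing_mul]

end Pairing

/-! ### The enveloping algebra pairing, the morphism `D̄` and the conclusion -/

section Main

variable {𝔤 : Type*} [LieRing 𝔤] [LieAlgebra ℂ 𝔤] [FiniteDimensional ℂ 𝔤] [LieAlgebra.IsSimple ℂ 𝔤]
  {𝔱 : LieSubalgebra ℂ 𝔤} [𝔱.IsCartanSubalgebra] {m : ℕ} {b : (rootSystem 𝔱).Base}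
  {ρ : 𝔤 →ₗ⁅ℂ⁆ Matrix (Fin m) (Fin m) ℂ}

theorem envPairing_seqMonomial (e : b.support → nilpotentPart b) (l : List b.support)
    (f : coordRing (unipotentGroup b ρ)) :
    envPairing (nilpotentRep b ρ) (seqMonomial b e l) f = wordPairing (nilpotentRep b ρ) e f l := by
  rw [envPairing, seqMonomial, map_list_prod, List.map_map, wordPairing, evalAt_apply]
  congr! 4
  ext1 j
  rw [Function.comp_apply, UniversalEnvelopingAlgebra.lift_ι_apply]

/-- The pullback of regular functions along a regular map to the unipotent group. -/
def regularPullback (n : RegularElement 𝔱 → unipotentGroup b ρ)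
    (hn : (fun x => ((n x : GL (Fin m) ℂ) : Matrix (Fin m) (Fin m) ℂ)) ∈ regularMatrices 𝔱 m) :
    coordRing (unipotentGroup b ρ) →ₐ[ℂ] regularFunctions 𝔱 :=
  AlgHom.codRestrict (AlgHom.pi (R := ℂ) (A := fun _ : RegularElement 𝔱 => ℂ)
      fun x => evalAt (nilpotentRep b ρ) (n x)) _ fun f => by
    refine coordRing_induction (P := fun f => (AlgHom.pi (R := ℂ)
      (A := fun _ : RegularElement 𝔱 => ℂ)
      fun x => evalAt (nilpotentRep b ρ) (n x)) f ∈ regularFunctions 𝔱) (fun i j => hn i j)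
      (fun r => ?_) (fun f g hf hg => ?_) (fun f g hf hg => ?_) f
    · rw [AlgHom.commutes]
      exact Subalgebra.algebraMap_mem _ r
    · rw [map_add]
      exact add_mem hf hg
    · rw [map_mul]
      exact mul_mem hf hg

end Main

end

theorem mainTheorem6 {𝔤 : Type*} [LieRing 𝔤] [LieAlgebra ℂ 𝔤] [FiniteDimensional ℂ 𝔤]
    [LieAlgebra.IsSimple ℂ 𝔤] (𝔱 : LieSubalgebra ℂ 𝔤) [𝔱.IsCartanSubalgebra]
    (b : (rootSystem 𝔱).Base) {m : ℕ} (ρ : 𝔤 →ₗ⁅ℂ⁆ Matrix (Fin m) (Fin m) ℂ)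
    (hρ : Function.Injective ρ) (e : b.support → nilpotentPart b)
    (he : ∀ i : b.support, (e i : 𝔤) ∈ rootSpace 𝔱 (i.1 : LieModule.Weight ℂ 𝔱 𝔤))
    (he0 : ∀ i : b.support, e i ≠ 0) :
    ∃ n : RegularElement 𝔱 → unipotentGroup b ρ,
      (∀ (x : RegularElement 𝔱) (g : unipotentGroup b ρ),
        AdEq ρ g (x.1 : 𝔤) ((x.1 : 𝔤) + ∑ i : b.support, (e i : 𝔤)) ↔ g = n x) ∧
      ∃ Dbar : coordRing (unipotentGroup b ρ) →ₐ[ℂ] regularFunctions 𝔱,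
        (∀ (f : coordRing (unipotentGroup b ρ)) (x : RegularElement 𝔱),
          (Dbar f : RegularElement 𝔱 → ℂ) x = (f : unipotentGroup b ρ → ℂ) (n x)) ∧
        ∀ f : coordRing (unipotentGroup b ρ),
          {i : List b.support |
            envPairing (nilpotentRep b ρ) (seqMonomial b e i) f ≠ 0}.Finite ∧
          ∀ x : RegularElement 𝔱, (∀ β ∈ rootCone b, β ≠ 0 → β x.1 ≠ 0) →
            (f : unipotentGroup b ρ → ℂ) (n x) =
              ∑ᶠ i : List b.support,
                envPairing (nilpotentRep b ρ) (seqMonomial b e i) f * seqCoeff b i x.1 := by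
  obtain ⟨n, hn, hconj⟩ := exists_regular_conj b ρ hρ
    (e := ∑ i : b.support, (e i : 𝔤)) (sum_mem fun i _ => (e i).2)
  have hfin : (Function.support fun l : List b.support =>
      (l.map fun j => nilpotentRep b ρ (e j)).prod).Finite := finite_support_wordMatrix b ρ he
  refine ⟨n, fun x g => ⟨fun h => eq_of_AdEq b ρ hρ x h (hconj x), fun h => h ▸ hconj x⟩,
    regularPullback n hn, fun f x => rfl, fun f => ⟨?_, fun x hx => ?_⟩⟩
  · simp only [envPairing_seqMonomial]
    exact finite_support_wordPairing hfin f
  · simp only [envPairing_seqMonomial]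
    have hg : ((n x : GL (Fin m) ℂ) : Matrix (Fin m) (Fin m) ℂ) = ∑ᶠ l : List b.support,
        seqCoeff b l x.1 • (l.map fun j => nilpotentRep b ρ (e j)).prod :=
      coe_eq_finsum_wordMatrix b ρ he hx (n x).2 (hconj x)
    refine eval_eq_finsum_wordPairing
      (β := fun j : b.support => (rootSystem 𝔱).root j x.1) (c := fun l => seqCoeff b l x.1)
      (fun l hl => ?_) (seqCoeff_nil b x.1) (fun j l => ?_) hfin hg f
    · rw [← wordWeight_apply]
      exact hx _ (wordWeight_mem_rootCone b l) (wordWeight_ne_zero b hl)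
    · rw [← wordWeight_apply]
      exact seqCoeff_cons b (hx _ (wordWeight_mem_rootCone b _) (wordWeight_ne_zero b (by simp)))
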